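/- Let $K$ be a field, $R=K[x_1,\dots,x_n]$ the polynomial ring with the standard grading $\deg x_i=1$, and $I\subset R$ a graded ideal of height (codimension) two such that $R/I$ is a Cohen–Macaulay ring. Let $$\cdots\to\bigoplus_{j\in\mathbb Z}R(-j)^{\beta_{2,j}}\to\bigoplus_{j\in\mathbb Z}R(-j)^{\beta_{1,j}}\to R\to 0$$ be the minimal graded free resolution of $R/I$ (it exists and is unique up to isomorphism), and for each $i$ for which the $i$-th free module is nonzero put $m_i=\min\{j\in\mathbb Z:\beta_{i,j}\neq 0\}$ and $M_i=\max\{j\in\mathbb Z:\beta_{i,j}\neq 0\}$. Let $e(R/I)$ denote the multiplicity of $R/I$: if $\sum_{k\ge 0}\dim_K (R/I)_k\,t^k=Q(t)/(1-t)^d$ with $d\ge 0$ an integer, $Q\in\mathbb Z[t]$ and $Q(1)\neq 0$, then $e(R/I)=Q(1)$. Then the following conditions are equivalent: 1. $e(R/I)=\frac12 m_1m_2$; 2. $e(R/I)=\frac12 M_1M_2$; 3. the minimal graded free resolution of $R/I$ is pure, that is, $m_i=M_i$ for every $i$ for which the $i$-th free module is nonzero. -/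

import Mathlib

namespace GradedAlg

open MvPolynomial

/-! ### Cohen-Macaulay rings -/

/-- A local ring `A` is Cohen-Macaulay if there is an `A`-regular sequence (necessarily in the
maximal ideal) whose length is the Krull dimension of `A`; that is, `depth A = dim A`. -/
def IsCohenMacaulayLocal (A : Type*) [CommRing A] : Prop :=
  ∃ rs : List A, RingTheory.Sequence.IsRegular A rs ∧
    (rs.length : WithBot ℕ∞) = ringKrullDim A

/-- A Cohen-Macaulay ring: a Noetherian ring all of whose localizations at maximal ideals are
Cohen-Macaulay local rings. -/
structure IsCohenMacaulayRing (A : Type*) [CommRing A] : Prop where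
  noetherian : IsNoetherianRing A
  localization : ∀ (m : Ideal A) [m.IsMaximal], IsCohenMacaulayLocal (Localization.AtPrime m)

section

variable {K : Type*} [Field K] {n : ℕ}

/-- Graded (homogeneous) ideals of the standard graded polynomial ring `K[x₁, …, xₙ]`. -/
def IsGradedIdeal (I : Ideal (MvPolynomial (Fin n) K)) : Prop :=
  letI : GradedAlgebra (homogeneousSubmodule (Fin n) K) := MvPolynomial.gradedAlgebra
  Ideal.IsHomogeneous (homogeneousSubmodule (Fin n) K) I

/-! ### Hilbert series and multiplicity -/

/-- The graded piece `(R/I)_k`, the image in `R/I` of the forms of degree `k`. -/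
noncomputable def gradedPiece (I : Ideal (MvPolynomial (Fin n) K)) (k : ℕ) :
    Submodule K (MvPolynomial (Fin n) K ⧸ I) :=
  (homogeneousSubmodule (Fin n) K k).map (Ideal.Quotient.mkₐ K I).toLinearMap

/-- The Hilbert series `∑ₖ dim_K (R/I)_k tᵏ`. -/
noncomputable def hilbertSeries (I : Ideal (MvPolynomial (Fin n) K)) : PowerSeries ℤ :=
  PowerSeries.mk fun k => (Module.finrank K (gradedPiece I k) : ℤ)

/-- `e` is the multiplicity of `R/I`: the Hilbert series has the reduced form
`Q(t) / (1 - t) ^ d` with `Q(1) ≠ 0`, and `e = Q(1)`. (The exponent `d` is then `dim R/I`.) -/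
def HasMultiplicity (I : Ideal (MvPolynomial (Fin n) K)) (e : ℤ) : Prop :=
  ∃ (d : ℕ) (Q : Polynomial ℤ), Q.eval 1 ≠ 0 ∧
    hilbertSeries I * (1 - PowerSeries.X) ^ d = (Q : PowerSeries ℤ) ∧ e = Q.eval 1

theorem HasMultiplicity.unique {I : Ideal (MvPolynomial (Fin n) K)} {e e' : ℤ}
    (h : HasMultiplicity I e) (h' : HasMultiplicity I e') : e = e' := by
  obtain ⟨d, Q, hQ, hH, rfl⟩ := h
  obtain ⟨d', Q', hQ', hH', rfl⟩ := h'
  have key : ∀ (a b : ℕ) (P P' : Polynomial ℤ), P'.eval 1 ≠ 0 →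
      hilbertSeries I * (1 - PowerSeries.X) ^ a = (P : PowerSeries ℤ) →
      hilbertSeries I * (1 - PowerSeries.X) ^ b = (P' : PowerSeries ℤ) → a ≤ b →
      P.eval 1 = P'.eval 1 := by
    intro a b P P' hP' h1 h2 hab
    obtain ⟨c, rfl⟩ := Nat.exists_eq_add_of_le hab
    have h3 : ((P * (1 - Polynomial.X) ^ c : Polynomial ℤ) : PowerSeries ℤ) = P' := by
      rw [← h2, pow_add, ← mul_assoc, h1]; simp
    have h4 : P * (1 - Polynomial.X) ^ c = P' := Polynomial.coe_injective ℤ h3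
    rcases Nat.eq_zero_or_pos c with rfl | hc
    · simp [← h4]
    · exact absurd (by simp [← h4, hc.ne']) hP'
  rcases le_total d d' with h | h
  · exact key d d' Q Q' hQ' hH hH' h
  · exact (key d' d Q' Q hQ hH' hH h).symm

open Classical in
/-- The multiplicity `e(R/I)` of a standard graded algebra (`0` for the zero algebra). -/
noncomputable def multiplicity (I : Ideal (MvPolynomial (Fin n) K)) : ℤ :=
  if h : ∃ e, HasMultiplicity I e then h.choose else 0

theorem HasMultiplicity.eq {I : Ideal (MvPolynomial (Fin n) K)} {e : ℤ}
    (h : HasMultiplicity I e) : multiplicity I = e := by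
  have h' : ∃ e, HasMultiplicity I e := ⟨e, h⟩
  rw [multiplicity, dif_pos h']
  exact h'.choose_spec.unique h

/-! ### Minimal graded free resolutions -/

/-- The polynomial `p` is homogeneous of degree `k ∈ ℤ` (hence zero if `k < 0`). -/
def IsHomogeneousInt (p : MvPolynomial (Fin n) K) (k : ℤ) : Prop :=
  ∀ s ∈ p.support, (s.degree : ℤ) = k

/-- A minimal graded free resolution
`⋯ → F₂ → F₁ → F₀ = R (→ R/I → 0)` of `R/I`, where `Fᵢ = ⨁ₐ R(-shift i a)` is a finitely generated
graded free module. -/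
structure MinimalGradedFreeResolution (I : Ideal (MvPolynomial (Fin n) K)) where
  /-- the rank of `Fᵢ` -/
  rank : ℕ → ℕ
  /-- the degrees of the basis elements of `Fᵢ` -/
  shift : ∀ i, Fin (rank i) → ℤ
  /-- the map `Fᵢ₊₁ → Fᵢ` -/
  d : ∀ i, (Fin (rank (i + 1)) → MvPolynomial (Fin n) K) →ₗ[MvPolynomial (Fin n) K]
    (Fin (rank i) → MvPolynomial (Fin n) K)
  /-- the maps are homogeneous of degree zero -/
  homogeneous : ∀ i b a,
    IsHomogeneousInt (d i (Pi.single b 1) a) (shift (i + 1) b - shift i a)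
  /-- `F₀ = R` -/
  rank_zero : rank 0 = 1
  shift_zero : ∀ a, shift 0 a = 0
  /-- the image of `F₁ → F₀ = R` is `I`, so that the cokernel is `R/I` -/
  range_zero : ∀ v, v ∈ LinearMap.range (d 0) ↔ ∀ a, v a ∈ I
  exact : ∀ i, Function.Exact (d (i + 1)) (d i)
  /-- minimality: the entries of the matrices lie in `(x₁, …, xₙ)` -/
  minimal : ∀ i b a, d i (Pi.single b 1) a ∈ idealOfVars (Fin n) K

namespace MinimalGradedFreeResolution

variable {I : Ideal (MvPolynomial (Fin n) K)} (F : MinimalGradedFreeResolution I)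

/-- The graded Betti number `β_{i,j}`: the multiplicity of `R(-j)` in `Fᵢ`. -/
def betti (i : ℕ) (j : ℤ) : ℕ := (Finset.univ.filter fun a => F.shift i a = j).card

/-- `mᵢ = min {j : β_{i,j} ≠ 0}` (meaningful when `Fᵢ ≠ 0`). -/
noncomputable def minShift (i : ℕ) : ℤ := sInf {j | F.betti i j ≠ 0}

/-- `Mᵢ = max {j : β_{i,j} ≠ 0}` (meaningful when `Fᵢ ≠ 0`). -/
noncomputable def maxShift (i : ℕ) : ℤ := sSup {j | F.betti i j ≠ 0}

/-- The resolution is pure: `mᵢ = Mᵢ` for all `i` with `Fᵢ ≠ 0`. -/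
def IsPure : Prop := ∀ i, F.rank i ≠ 0 → F.minShift i = F.maxShift i

end MinimalGradedFreeResolution

end

end GradedAlg

namespace GradedAlg

open MvPolynomial

section

variable {K : Type*} [Field K] {n : ℕ}

/-! ### Existence of minimal graded free resolutions -/

/-- The homogeneous component of degree `k ∈ ℤ` of a polynomial. -/
noncomputable def componentInt (k : ℤ) (p : MvPolynomial (Fin n) K) : MvPolynomial (Fin n) K :=
  if 0 ≤ k then homogeneousComponent k.toNat p else 0

theorem coeff_componentInt (k : ℤ) (p : MvPolynomial (Fin n) K) (s : Fin n →₀ ℕ) :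
    coeff s (componentInt k p) = if (s.degree : ℤ) = k then coeff s p else 0 := by
  unfold componentInt
  by_cases hk : 0 ≤ k
  · obtain ⟨k, rfl⟩ := Int.eq_ofNat_of_zero_le hk
    simp [coeff_homogeneousComponent]
  · have : (s.degree : ℤ) ≠ k := by have := Int.natCast_nonneg s.degree; omega
    simp [hk, this]

theorem isHomogeneousInt_componentInt (k : ℤ) (p : MvPolynomial (Fin n) K) :
    IsHomogeneousInt (componentInt k p) k := by
  intro s hs
  rw [mem_support_iff, coeff_componentInt] at hs
  by_contra h
  simp [h] at hs

theorem componentInt_mul {g : MvPolynomial (Fin n) K} {e : ℤ} (hg : IsHomogeneousInt g e)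
    (k : ℤ) (p : MvPolynomial (Fin n) K) :
    componentInt k (p * g) = componentInt (k - e) p * g := by
  ext s
  rw [coeff_componentInt, coeff_mul, coeff_mul]
  have key : ∀ x ∈ Finset.HasAntidiagonal.antidiagonal s,
      coeff x.1 (componentInt (k - e) p) * coeff x.2 g
        = if (s.degree : ℤ) = k then coeff x.1 p * coeff x.2 g else 0 := by
    intro x hx
    rw [Finset.HasAntidiagonal.mem_antidiagonal] at hx
    by_cases h0 : coeff x.2 g = 0
    · simp [h0]
    · have h1 := hg x.2 (mem_support_iff.2 h0)
      have h2 : s.degree = x.1.degree + x.2.degree := by rw [← hx, map_add]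
      rw [coeff_componentInt]
      by_cases h3 : (s.degree : ℤ) = k
      · rw [if_pos h3, if_pos (by omega)]
      · rw [if_neg h3, if_neg (by omega), zero_mul]
  rw [Finset.sum_congr rfl key]
  split_ifs <;> simp

theorem componentInt_sum {ι : Type*} (T : Finset ι) (k : ℤ) (f : ι → MvPolynomial (Fin n) K) :
    componentInt k (∑ a ∈ T, f a) = ∑ a ∈ T, componentInt k (f a) := by
  ext s
  simp only [coeff_componentInt, coeff_sum]
  split_ifs <;> simp

/-- A submodule of a graded free module `⨁ₐ R(-δ a)` is graded. -/
def IsGradedSub {r : ℕ} (δ : Fin r → ℤ)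
    (N : Submodule (MvPolynomial (Fin n) K) (Fin r → MvPolynomial (Fin n) K)) : Prop :=
  ∀ v ∈ N, ∀ j : ℤ, (fun a => componentInt (j - δ a) (v a)) ∈ N

theorem IsGradedSub.span_eq {r : ℕ} {δ : Fin r → ℤ}
    {N : Submodule (MvPolynomial (Fin n) K) (Fin r → MvPolynomial (Fin n) K)}
    (hN : IsGradedSub δ N) :
    Submodule.span (MvPolynomial (Fin n) K)
      {v | v ∈ N ∧ ∃ j : ℤ, ∀ a, IsHomogeneousInt (v a) (j - δ a)} = N := by
  classical
  apply le_antisymm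
  · rw [Submodule.span_le]
    exact fun v hv => hv.1
  · intro v hv
    let T : Finset ℤ := Finset.univ.biUnion fun a =>
      (v a).support.image fun s => (s.degree : ℤ) + δ a
    have : v = ∑ j ∈ T, fun a => componentInt (j - δ a) (v a) := by
      funext a
      ext s
      rw [Finset.sum_apply, coeff_sum]
      simp only [coeff_componentInt]
      by_cases hs : coeff s (v a) = 0
      · simp [hs]
      · rw [Finset.sum_eq_single ((s.degree : ℤ) + δ a)]
        · simp
        · intro j _ hj
          rw [if_neg]
          omega
        · intro h
          exact absurd (Finset.mem_biUnion.2 ⟨a, Finset.mem_univ a,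
            Finset.mem_image.2 ⟨s, mem_support_iff.2 hs, rfl⟩⟩) h
    rw [this]
    exact Submodule.sum_mem _ fun j _ => Submodule.subset_span
      ⟨hN v hv j, j, fun a => isHomogeneousInt_componentInt _ _⟩

/-- One step of the construction of a minimal resolution: a minimal homogeneous generating
system, with its module of relations. -/
theorem IsGradedSub.exists_cover {r : ℕ} {δ : Fin r → ℤ}
    {N : Submodule (MvPolynomial (Fin n) K) (Fin r → MvPolynomial (Fin n) K)}
    (hN : IsGradedSub δ N) :
    ∃ (s : ℕ) (ε : Fin s → ℤ) (f : (Fin s → MvPolynomial (Fin n) K) →ₗ[MvPolynomial (Fin n) K]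
        (Fin r → MvPolynomial (Fin n) K)),
      LinearMap.range f = N ∧
      (∀ b a, IsHomogeneousInt (f (Pi.single b 1) a) (ε b - δ a)) ∧
      IsGradedSub ε (LinearMap.ker f) ∧
      ∀ v ∈ LinearMap.ker f, ∀ b, constantCoeff (v b) = 0 := by
  classical
  have hex : ∃ (s : ℕ) (g : Fin s → Fin r → MvPolynomial (Fin n) K),
      (∀ b, ∃ j : ℤ, ∀ a, IsHomogeneousInt (g b a) (j - δ a)) ∧
      Submodule.span (MvPolynomial (Fin n) K) (Set.range g) = N := by
    have hfg := IsNoetherian.noetherian (R := MvPolynomial (Fin n) K)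
      (Submodule.span (MvPolynomial (Fin n) K)
        {v | v ∈ N ∧ ∃ j : ℤ, ∀ a, IsHomogeneousInt (v a) (j - δ a)})
    obtain ⟨S, hS, hspan⟩ := (Submodule.fg_span_iff_fg_span_finset_subset _).1 hfg
    refine ⟨S.card, fun b => (S.equivFin.symm b : _), fun b => (hS (S.equivFin.symm b).2).2, ?_⟩
    rw [← hN.span_eq, hspan]
    congr 1
    ext v
    constructor
    · rintro ⟨b, rfl⟩
      exact (S.equivFin.symm b).2
    · intro hv
      exact ⟨S.equivFin ⟨v, hv⟩, by simp⟩
  obtain ⟨g, hg, hspan⟩ := Nat.find_spec hex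
  have hmin := fun m => Nat.find_min (m := m) hex
  generalize Nat.find hex = s at g hg hspan hmin
  choose ε hε using hg
  let f := Fintype.linearCombination (MvPolynomial (Fin n) K) g
  have hf : ∀ v, f v = ∑ b, v b • g b := fun v => Fintype.linearCombination_apply _ _ _
  have hker : IsGradedSub ε (LinearMap.ker f) := by
    intro v hv j
    rw [LinearMap.mem_ker, hf] at hv ⊢
    funext a
    have h1 := congrFun hv a
    simp only [Finset.sum_apply, Pi.smul_apply, smul_eq_mul, Pi.zero_apply] at h1 ⊢
    have h2 : ∑ b, componentInt (j - ε b) (v b) * g b a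
        = componentInt (j - δ a) (∑ b, v b * g b a) := by
      rw [componentInt_sum]
      refine Finset.sum_congr rfl fun b _ => ?_
      rw [componentInt_mul (hε b a)]
      congr 2
      ring
    rw [h2, h1]
    ext t
    simp [coeff_componentInt]
  refine ⟨s, ε, f, ?_, ?_, hker, ?_⟩
  · rw [← hspan]
    exact Fintype.range_linearCombination (MvPolynomial (Fin n) K) g
  · intro b a
    have : f (Pi.single b 1) = g b := by
      rw [Fintype.linearCombination_apply_single, one_smul]
    rw [this]
    exact hε b a
  · intro v hv b
    by_contra hc
    have hw := hker v hv (ε b)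
    set w : Fin s → MvPolynomial (Fin n) K := fun a => componentInt (ε b - ε a) (v a) with hwdef
    have hwb : w b = C (constantCoeff (v b)) := by
      ext t
      rw [hwdef]
      simp only [coeff_componentInt, sub_self, coeff_C, constantCoeff_eq]
      by_cases ht : t = 0
      · simp [ht]
      · have h3 : t.degree ≠ 0 := by rwa [Ne, Finsupp.degree_eq_zero_iff]
        rw [if_neg (by exact_mod_cast h3), if_neg (fun h => ht h.symm)]
    rw [LinearMap.mem_ker, hf] at hw
    obtain _ | s := s
    · exact b.elim0
    rw [Fin.sum_univ_succAbove _ b, hwb] at hw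
    refine hmin s (Nat.lt_succ_self s) ⟨fun i => g (b.succAbove i),
      fun i => ⟨ε (b.succAbove i), hε _⟩, ?_⟩
    rw [← hspan]
    apply le_antisymm
    · apply Submodule.span_mono
      rintro _ ⟨i, rfl⟩
      exact ⟨_, rfl⟩
    · rw [Submodule.span_le]
      rintro _ ⟨i, rfl⟩
      rcases Fin.eq_self_or_eq_succAbove b i with rfl | ⟨k, rfl⟩
      · have h4 : g i = - ((C (constantCoeff (v i))⁻¹ : MvPolynomial (Fin n) K) •
            ∑ k, w (i.succAbove k) • g (i.succAbove k)) := by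
          have h5 := eq_neg_of_add_eq_zero_left hw
          rw [← smul_neg, ← h5, smul_smul, ← C_mul, inv_mul_cancel₀ hc, C_1, one_smul]
        rw [h4]
        exact Submodule.neg_mem _ (Submodule.smul_mem _ _ (Submodule.sum_mem _ fun k _ =>
          Submodule.smul_mem _ _ (Submodule.subset_span ⟨k, rfl⟩)))
      · exact Submodule.subset_span ⟨k, rfl⟩

/-- A graded submodule of `(x₁, …, xₙ) F`, with `F` a graded free module: the syzygy module
at one stage of the construction of a minimal resolution. -/
structure SyzygyStage (K : Type*) [Field K] (n : ℕ) where
  r : ℕ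
  δ : Fin r → ℤ
  N : Submodule (MvPolynomial (Fin n) K) (Fin r → MvPolynomial (Fin n) K)
  graded : IsGradedSub δ N
  minimal : ∀ v ∈ N, ∀ b, constantCoeff (v b) = 0

theorem SyzygyStage.exists_next (S : SyzygyStage K n) :
    ∃ (S' : SyzygyStage K n)
      (f : (Fin S'.r → MvPolynomial (Fin n) K) →ₗ[MvPolynomial (Fin n) K]
        (Fin S.r → MvPolynomial (Fin n) K)),
      LinearMap.range f = S.N ∧ LinearMap.ker f = S'.N ∧
      ∀ b a, IsHomogeneousInt (f (Pi.single b 1) a) (S'.δ b - S.δ a) := by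
  obtain ⟨s, ε, f, h1, h2, h3, h4⟩ := S.graded.exists_cover
  exact ⟨⟨s, ε, LinearMap.ker f, h3, h4⟩, f, h1, rfl, h2⟩

theorem mem_idealOfVars_of_constantCoeff {p : MvPolynomial (Fin n) K}
    (h : constantCoeff p = 0) : p ∈ idealOfVars (Fin n) K := by
  rw [← pow_one (idealOfVars (Fin n) K), mem_pow_idealOfVars_iff']
  intro x hx
  have : x = 0 := by
    rw [← Finsupp.degree_eq_zero_iff]
    omega
  rw [this, ← constantCoeff_eq, h]

theorem IsGradedIdeal.componentInt_mem {I : Ideal (MvPolynomial (Fin n) K)}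
    (hI : IsGradedIdeal I) {p : MvPolynomial (Fin n) K} (hp : p ∈ I) (k : ℤ) :
    componentInt k p ∈ I := by
  unfold componentInt
  split_ifs
  · let _ : GradedAlgebra (homogeneousSubmodule (Fin n) K) := MvPolynomial.gradedAlgebra
    have := hI k.toNat hp
    exact (decomposition.decompose'_apply p k.toNat) ▸ this
  · exact I.zero_mem

/-- Minimal graded free resolutions exist. -/
theorem exists_minimalGradedFreeResolution {I : Ideal (MvPolynomial (Fin n) K)}
    (hI : IsGradedIdeal I) (hI' : I ≠ ⊤) : Nonempty (MinimalGradedFreeResolution I) := by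
  choose next f hrange hker hhom using SyzygyStage.exists_next (K := K) (n := n)
  let S₀ : SyzygyStage K n :=
    { r := 1
      δ := fun _ => 0
      N := Submodule.pi Set.univ fun _ => I
      graded := fun v hv j => by
        rw [Submodule.mem_pi] at hv ⊢
        exact fun a ha => hI.componentInt_mem (hv a ha) _
      minimal := fun v hv b => by
        by_contra hc
        rw [Submodule.mem_pi] at hv
        have h1 := hI.componentInt_mem (hv b trivial) 0
        have h2 : componentInt 0 (v b) = C (constantCoeff (v b)) := by
          ext t
          simp only [coeff_componentInt, coeff_C, constantCoeff_eq]
          by_cases ht : t = 0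
          · simp [ht]
          · have h3 : t.degree ≠ 0 := by rwa [Ne, Finsupp.degree_eq_zero_iff]
            rw [if_neg (by exact_mod_cast h3), if_neg (fun h => ht h.symm)]
        rw [h2] at h1
        exact hI' (Ideal.eq_top_of_isUnit_mem _ h1 ((IsUnit.mk0 _ hc).map C)) }
  let S : ℕ → SyzygyStage K n := fun i => Nat.rec S₀ (fun _ T => next T) i
  exact ⟨{
    rank := fun i => (S i).r
    shift := fun i => (S i).δ
    d := fun i => f (S i)
    homogeneous := fun i b a => hhom (S i) b a
    rank_zero := rfl
    shift_zero := fun _ => rfl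
    range_zero := fun v => by
      rw [hrange (S 0)]
      exact (Submodule.mem_pi (p := fun _ => I)).trans ⟨fun h a => h a trivial, fun h a _ => h a⟩
    exact := fun i => by
      rw [LinearMap.exact_iff, hrange (S (i + 1)), hker (S i)]
    minimal := fun i b a => by
      apply mem_idealOfVars_of_constantCoeff
      apply (S i).minimal
      rw [← hrange (S i)]
      exact ⟨_, rfl⟩ }⟩

end

end GradedAlg

/-! Write `a i` for the shifts of `F₁` and `b j` for those of `F₂`. Localizing at the irrelevant
ideal, the Cohen–Macaulay hypothesis in codimension two forces projective dimension at most two. By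
minimality the resolution is then `0 → F₂ → F₁ → R` (`d_two_eq_zero`).

Hilbert–Burch (`exists_isUnit_det_adjoinCol_eq`) says that the generators of `I` are, up to a common
unit, the maximal minors of the relation matrix. Comparing degrees gives `∑ b = ∑ a`. Since the
minor omitting row `i` is nonzero, some term of its expansion is nonzero. This matches the columns
`j` with the rows `e j ≠ i`, and minimality gives `a (e j) < b j` (`sum_shift_eq_and_exists_equiv`).

The Hilbert series has numerator `1 - ∑ t ^ a + ∑ t ^ b` over `(1 - t) ^ n`. Its value and first
derivative vanish at `1`, and its second derivative gives `2 e(R/I) = ∑ b² - ∑ a²`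
(`two_mul_multiplicity`).

Because `∑ (b j - a (e j)) = a i`, for every integer `m` `∑ b² - ∑ a² = a i * m + ∑ (b j - a (e j))
* ((b j - m) + (a (e j) - a i))` (`sum_sq_sub_sum_sq`). With `a i` and `m` both minimal, every
summand on the right is nonnegative; with both maximal, every summand is nonpositive. As the first
factors are positive, equality with `m₁m₂` or `M₁M₂` forces all shifts in each step to agree, and
conversely purity makes the sum vanish. -/

/-! ### Depth, dimension and projective dimension over Noetherian local rings. -/

section LocalAlgebra

open RingTheory.Sequence IsLocalRing CategoryTheory Abelian Pointwise

universe u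

variable {S : Type u} [CommRing S] [IsLocalRing S] [IsNoetherianRing S]

/-- An associated prime of `B` is strictly contained in an associated prime of `B / r B`, if `r`
is a `B`-regular element of the maximal ideal. -/
theorem exists_lt_mem_associatedPrimes_quotSMulTop {B : Type*} [AddCommGroup B] [Module S B]
    [Module.Finite S B] {r : S} (hr : IsSMulRegular B r) (hrm : r ∈ maximalIdeal S)
    {P : Ideal S} (hP : P ∈ associatedPrimes S B) :
    ∃ P' ∈ associatedPrimes S (QuotSMulTop r B), P < P' := by
  obtain ⟨hPp, b, hb⟩ := isAssociatedPrime_iff.1 hP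
  have hbP : ∀ p ∈ P, p • b = 0 := fun p hp => by
    rw [hb, Submodule.mem_colon_singleton] at hp
    simpa using hp
  have hb0 : b ≠ 0 := by
    rintro rfl
    apply hPp.ne_top
    rw [hb]
    ext
    simp [Submodule.mem_colon_singleton]
  let N : Submodule S B := Submodule.torsionBySet S B P
  have hN : ∀ x, x ∈ N ↔ ∀ p ∈ P, p • x = 0 := fun x => by
    simp [N, Submodule.mem_torsionBySet_iff]
  -- If `N ⊆ rB`, then regularity of `r` makes `N = rN`, and Nakayama kills `N`, which contains `b ≠
  -- 0`. The class of such an `x` is nonzero and is annihilated by both `P` and `r`.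
  have hex : ∃ x ∈ N, x ∉ r • (⊤ : Submodule S B) := by
    by_contra! h
    have hle : N ≤ maximalIdeal S • N := by
      intro x hx
      obtain ⟨y, -, rfl⟩ := (Submodule.mem_smul_pointwise_iff_exists _ _ _).1 (h x hx)
      refine Submodule.smul_mem_smul hrm ((hN y).2 fun p hp => hr ?_)
      change r • p • y = r • 0
      rw [smul_zero, smul_comm]
      exact (hN _).1 hx p hp
    have := Submodule.eq_bot_of_le_smul_of_le_jacobson_bot _ N (IsNoetherian.noetherian N) hle
      (maximalIdeal_le_jacobson _)
    exact hb0 ((Submodule.mem_bot S).1 (this ▸ (hN b).2 hbP))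
  obtain ⟨x, hxN, hx⟩ := hex
  have hx0 : (Submodule.Quotient.mk x : QuotSMulTop r B) ≠ 0 := fun h =>
    hx ((Submodule.Quotient.mk_eq_zero _).1 h)
  obtain ⟨P', hP', hle⟩ := exists_le_isAssociatedPrime_of_isNoetherianRing S _ hx0
  refine ⟨P', hP', lt_of_le_of_ne (fun p hp => hle ?_) ?_⟩
  · rw [Submodule.mem_colon_singleton, ← Submodule.Quotient.mk_smul, (hN x).1 hxN p hp]
    simp
  -- The inclusion is strict: `r` lies in `P'`, but not in `P`, since it is regular on `B` while `P`
  -- annihilates `b ≠ 0`.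
  · rintro rfl
    have h1 : r ∈ P := hle (by
      rw [Submodule.mem_colon_singleton, ← Submodule.Quotient.mk_smul, Submodule.mem_bot,
        Submodule.Quotient.mk_eq_zero]
      exact Submodule.smul_mem_pointwise_smul _ _ _ trivial)
    refine hb0 (hr ?_)
    change r • b = r • 0
    rw [smul_zero, hbP r h1]

/-- The dimension of `S / P` is at least the length of any `B`-regular sequence, for an associated
prime `P` of `B`. -/
theorem length_le_ringKrullDim_of_mem_associatedPrimes (rs : List S) :
    ∀ {B : Type u} [AddCommGroup B] [Module S B] [Module.Finite S B],
      IsWeaklyRegular B rs → (∀ r ∈ rs, r ∈ maximalIdeal S) →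
      ∀ {P : Ideal S}, P ∈ associatedPrimes S B →
        (rs.length : WithBot ℕ∞) ≤ ringKrullDim (S ⧸ P) := by
  induction rs with
  | nil =>
    intro B _ _ _ _ _ P hP
    have := hP.isPrime
    simpa using ringKrullDim_nonneg_of_nontrivial (R := S ⧸ P)
  | cons r rs ih =>
    intro B _ _ _ hreg hmem P hP
    rw [isWeaklyRegular_cons_iff] at hreg
    simp only [List.mem_cons, forall_eq_or_imp] at hmem
    obtain ⟨P', hP', hlt⟩ := exists_lt_mem_associatedPrimes_quotSMulTop hreg.1 hmem.1 hP
    have := hP.isPrime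
    have h1 := ih hreg.2 hmem.2 hP'
    obtain ⟨y, hy, hyP⟩ := Set.exists_of_ssubset hlt
    have h2 := ringKrullDim_succ_le_of_surjective (Ideal.Quotient.factor hlt.le)
      (Ideal.Quotient.factor_surjective hlt.le) (r := Ideal.Quotient.mk P y)
      (mem_nonZeroDivisors_of_ne_zero (by rwa [Ne, Ideal.Quotient.eq_zero_iff_mem]))
      (by simpa [Ideal.Quotient.eq_zero_iff_mem] using hy)
    rw [List.length_cons, Nat.cast_add, Nat.cast_one]
    exact (add_le_add_left h1 1).trans h2

/-- Passing to the quotient by a regular element lowers the depth by at most one. -/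
theorem exists_isRegular_quotSMulTop {M : Type u} [AddCommGroup M] [Module S M]
    [Module.Finite S M] {k : ℕ}
    (h : ∃ rs : List S, rs.length = k + 1 ∧ (∀ r ∈ rs, r ∈ maximalIdeal S) ∧
      RingTheory.Sequence.IsRegular M rs)
    {r : S} (hr : IsSMulRegular M r) (hrm : r ∈ maximalIdeal S) :
    ∃ rs : List S, rs.length = k ∧ (∀ r ∈ rs, r ∈ maximalIdeal S) ∧
      RingTheory.Sequence.IsRegular (QuotSMulTop r M) rs := by
  obtain ⟨rs, hlen, hmem, hreg⟩ := h
  have := hreg.nontrivial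
  have hlt : ∀ (L : Type u) [AddCommGroup L] [Module S L] [Module.Finite S L] [Nontrivial L],
      maximalIdeal S • (⊤ : Submodule S L) < ⊤ := fun L _ _ _ _ => by
    refine lt_top_iff_ne_top.2 fun h => ?_
    exact top_ne_bot (Submodule.eq_bot_of_le_smul_of_le_jacobson_bot (maximalIdeal S) ⊤
      Module.Finite.fg_top h.ge (maximalIdeal_le_jacobson _))
  have hsupp : Module.support S (S ⧸ maximalIdeal S) =
      PrimeSpectrum.zeroLocus (maximalIdeal S) := by
    rw [Module.support_eq_zeroLocus, Ideal.annihilator_quotient]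
  let N : ModuleCat.{u} S := ModuleCat.of S (S ⧸ maximalIdeal S)
  -- Depth is read off from the vanishing of `Ext` out of the residue field. The long exact sequence
  -- of multiplication by `r` then costs one degree.
  have hE := ModuleCat.subsingleton_ext_of_exists_isRegular (maximalIdeal S) N hsupp.le
    (ModuleCat.of S M) (hlt M) rs hmem hreg
  have := nontrivial_quotSMulTop_of_mem_maximalIdeal M hrm
  refine ModuleCat.exists_isRegular_of_exists_subsingleton_ext (maximalIdeal S) k
    (ModuleCat.of S (QuotSMulTop r M)) (hlt _) N hsupp fun i hi => ?_
  have zero1 := AddCommGrpCat.isZero_of_iff_subsingleton.mpr (hE i (by omega))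
  have zero2 := AddCommGrpCat.isZero_of_iff_subsingleton.mpr (hE (i + 1) (by omega))
  have hr' : IsSMulRegular (ModuleCat.of S M) r := hr
  exact AddCommGrpCat.subsingleton_of_isZero <| ShortComplex.Exact.isZero_of_both_zeros
    ((Ext.covariant_sequence_exact₃' N hr'.smulShortComplex_shortExact) i (i + 1) rfl)
    (zero1.eq_zero_of_src _) (zero2.eq_zero_of_tgt _)

/-- A prime of height two in a local factorial domain of depth `≥ k + 2` has
dimension at least `k`. -/
theorem le_ringKrullDim_quotient_of_height_eq_two [IsDomain S] [UniqueFactorizationMonoid S] {k : ℕ}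
    (h : ∃ rs : List S, rs.length = k + 2 ∧ (∀ r ∈ rs, r ∈ maximalIdeal S) ∧
      RingTheory.Sequence.IsRegular S rs)
    {P : Ideal S} [hP : P.IsPrime] (hht : P.height = 2) :
    (k : WithBot ℕ∞) ≤ ringKrullDim (S ⧸ P) := by
  have hPbot : P ≠ ⊥ := by
    rintro rfl
    simp at hht
  obtain ⟨f, hfP, hf⟩ := hP.exists_mem_prime_of_ne_bot hPbot
  have hfprime : (Ideal.span {f}).IsPrime := (Ideal.span_singleton_prime hf.ne_zero).2 hf
  have hne : Ideal.span {f} ≠ P := by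
    rintro rfl
    have := Ideal.height_span_singleton_le_one hf.not_isUnit
    rw [hht] at this
    exact absurd this (by decide)
  have hlt : Ideal.span {f} < P :=
    lt_of_le_of_ne ((Ideal.span_singleton_le_iff_mem P).2 hfP) hne
  obtain ⟨g, hgP, hg⟩ := Set.exists_of_ssubset hlt
  have hPm : P ≤ maximalIdeal S := le_maximalIdeal hP.ne_top
  have hfreg : IsSMulRegular S f := (IsRegular.of_ne_zero hf.ne_zero).isSMulRegular
  have htop : f • (⊤ : Submodule S S) = Ideal.span {f} := by
    rw [← Submodule.ideal_span_singleton_smul]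
    simp
  -- As `(f)` is prime and `g ∉ (f)`, the pair `f, g` is a regular sequence in `P`. So `S/(f, g)`
  -- has depth at least `k`, which bounds the dimension at each of its associated primes.
  have hgreg : IsSMulRegular (QuotSMulTop f S) g := by
    rw [isSMulRegular_quotient_iff_mem_of_smul_mem]
    intro x hx
    rw [htop] at hx ⊢
    exact (hfprime.mem_or_mem hx).resolve_left hg
  obtain ⟨rs, hlen, hmem, hreg⟩ := exists_isRegular_quotSMulTop
    (exists_isRegular_quotSMulTop h hfreg (hPm hfP)) hgreg (hPm hgP)
  rw [← hlen]
  refine length_le_ringKrullDim_of_mem_associatedPrimes rs hreg.1 hmem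
    (Module.associatedPrimes.minimalPrimes_annihilator_subset_associatedPrimes S _ ?_)
  have hsupp : ∀ q : PrimeSpectrum S,
      Module.annihilator S (QuotSMulTop g (QuotSMulTop f S)) ≤ q.asIdeal ↔
        f ∈ q.asIdeal ∧ g ∈ q.asIdeal := fun q => by
    rw [← Module.mem_support_iff_of_finite, Module.support_quotSMulTop,
      Module.support_quotSMulTop]
    simp [Module.support_of_algebra,
      (RingHom.injective_iff_ker_eq_bot (RingHom.id S)).1 Function.injective_id]
  -- `P` is minimal over `(f, g)`: a smaller prime `q` would give the chain `0 < (f) < q < P`,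
  -- contradicting height two.
  refine ⟨⟨hP, (hsupp ⟨P, hP⟩).2 ⟨hfP, hgP⟩⟩, fun q hq hle => ?_⟩
  obtain ⟨hq, hq'⟩ := hq
  obtain ⟨hfq, hgq⟩ := (hsupp ⟨q, hq⟩).1 hq'
  have h1 : Ideal.span {f} < q := lt_of_le_of_ne ((Ideal.span_singleton_le_iff_mem q).2 hfq)
    (fun h => hg (h ▸ hgq))
  have h0 : (⊥ : Ideal S) < Ideal.span {f} := bot_lt_iff_ne_bot.2 (by
    simpa using hf.ne_zero)
  by_contra hne
  have h2 : q < P := lt_of_le_of_ne hle (fun h => hne h.ge)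
  have a1 := Ideal.height_add_one_le_of_lt_of_isPrime h0
  have a2 := Ideal.height_add_one_le_of_lt_of_isPrime h1
  have a3 := Ideal.height_add_one_le_of_lt_of_isPrime h2
  rw [hht] at a3
  have a4 : (1 : ℕ∞) + 1 + 1 ≤ 2 := by
    refine le_trans ?_ a3
    gcongr
    refine le_trans ?_ a2
    gcongr
    refine le_trans ?_ a1
    simp
  exact absurd a4 (by decide)

/-- If the maximal ideal is generated by a regular sequence of length `n`, then modules of finite
length have projective dimension at most `n`. -/
theorem projectiveDimension_le_of_support_subset {rs : List S}
    (hreg : RingTheory.Sequence.IsRegular S rs) (hrs : Ideal.ofList rs = maximalIdeal S)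
    {N : Type u} [AddCommGroup N] [Module S N] [hN : Module.Finite S N]
    (hsupp : Module.support S N ⊆ PrimeSpectrum.zeroLocus (maximalIdeal S)) :
    projectiveDimension (ModuleCat.of S N) ≤ rs.length := by
  have hk : projectiveDimension (ModuleCat.of S (S ⧸ maximalIdeal S)) ≤ rs.length := by
    have := ModuleCat.projectiveDimension_quotient_eq_length.{u} rs hreg
    rw [hrs] at this
    rw [← this]
    exact (ModuleCat.projectiveDimension_eq_of_linearEquiv (Shrink.linearEquiv S _).symm).le
  -- Dévissage by a prime filtration: the support condition leaves only the residue field as a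
  -- factor `S/p`.
  induction hN using IsNoetherianRing.induction_on_isQuotientEquivQuotientPrime S with
  | subsingleton N =>
    rw [(projectiveDimension_eq_bot_iff _).2 (ModuleCat.isZero_of_subsingleton (ModuleCat.of S N))]
    exact bot_le
  | quotient N p e =>
    have hp : p.asIdeal = maximalIdeal S := by
      have h1 : p ∈ Module.support S N := by
        rw [e.support_eq, Module.support_eq_zeroLocus, Ideal.annihilator_quotient]
        exact (PrimeSpectrum.mem_zeroLocus _ _).2 (le_refl p.asIdeal)
      exact le_antisymm (le_maximalIdeal p.2.ne_top) (hsupp h1)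
    rw [hp] at e
    rwa [ModuleCat.projectiveDimension_eq_of_linearEquiv (M := ModuleCat.of S N)
      (N := ModuleCat.of S (S ⧸ maximalIdeal S)) e]
  | exact N₁ N₂ N₃ f g hf hg hfg h1 h3 =>
    have hU := Module.support_of_exact hfg hf hg
    have h1' := h1 ((Set.subset_union_left.trans hU.ge).trans hsupp)
    have h3' := h3 ((Set.subset_union_right.trans hU.ge).trans hsupp)
    rw [projectiveDimension_le_iff] at h1' h3' ⊢
    exact (ModuleCat.shortComplex_shortExact
      (ModuleCat.shortComplexOfCompEqZero f g hfg.linearMap_comp_eq_zero) hfg hf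
      hg).hasProjectiveDimensionLT_X₂ _ h1' h3'

/-- A Cohen-Macaulay quotient of a local factorial domain with maximal ideal generated by a regular
sequence has projective dimension at most two, if its kernel is contained in a prime of
height two. -/
theorem projectiveDimension_le_two_of_isCohenMacaulayLocal [IsDomain S]
    [UniqueFactorizationMonoid S] {rs : List S} (hreg : RingTheory.Sequence.IsRegular S rs)
    (hrs : Ideal.ofList rs = maximalIdeal S) (hlen : 2 ≤ rs.length)
    {P : Ideal S} [hP : P.IsPrime] (hht : P.height = 2)
    {A : Type u} [CommRing A] [Algebra S A] (hsurj : Function.Surjective (algebraMap S A))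
    (hker : RingHom.ker (algebraMap S A) ≤ P) (hA : GradedAlg.IsCohenMacaulayLocal A) :
    projectiveDimension (ModuleCat.of S A) ≤ 2 := by
  have hmem : ∀ r ∈ rs, r ∈ maximalIdeal S := fun r hr =>
    hrs ▸ Ideal.subset_span hr
  obtain ⟨k, hk⟩ := Nat.exists_eq_add_of_le' hlen
  have hkS := le_ringKrullDim_quotient_of_height_eq_two ⟨rs, hk, hmem, hreg⟩ hht
  obtain ⟨rsA, hregA, hdim⟩ := hA
  have : Nontrivial A := hregA.nontrivial
  have : IsLocalRing A := IsLocalRing.of_surjective' _ hsurj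
  have : IsNoetherianRing A := isNoetherianRing_of_surjective S A _ hsurj
  have : Module.Finite S A := Module.Finite.of_surjective (Algebra.linearMap S A) hsurj
  obtain ⟨rs', rfl⟩ := hsurj.list_map rsA
  rw [List.length_map] at hdim
  have hD := ringKrullDim_add_length_eq_ringKrullDim_of_isRegular _ hregA
  rw [List.length_map, ← hdim] at hD
  have hmem' : ∀ r ∈ rs', r ∈ maximalIdeal S := fun r hr hu => by
    refine hregA.2 ?_
    have h1 : algebraMap S A r ∈ Ideal.ofList (rs'.map (algebraMap S A)) :=
      Ideal.subset_span (List.mem_map_of_mem hr)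
    rw [Ideal.eq_top_of_isUnit_mem _ h1 (hu.map _)]
    simp
  -- Dividing `A` by a regular sequence of length `dim A` raises the projective dimension by `dim A`
  -- and leaves a module supported at the closed point, where the bound `rs.length` applies. Since
  -- `dim A ≥ dim S/P ≥ rs.length - 2`, at most two remains for `A`.
  have hpd := ModuleCat.projectiveDimension_quotient_eq_add_length_of_isWeaklyRegular
    (ModuleCat.of S A) rs' ((isWeaklyRegular_map_algebraMap_iff A A rs').1 hregA.1) hmem'
  have hle := projectiveDimension_le_of_support_subset
    (N := A ⧸ Ideal.ofList rs' • (⊤ : Submodule S A))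
    hreg hrs (by
      intro p hp
      rw [Module.mem_support_iff_of_finite] at hp
      let φ := (Ideal.Quotient.mk (Ideal.ofList (rs'.map (algebraMap S A)))).comp (algebraMap S A)
      have hφ : Function.Surjective φ := Ideal.Quotient.mk_surjective.comp hsurj
      have hkerφ : RingHom.ker φ ≤ p.asIdeal := by
        refine le_trans (fun s hs => ?_) hp
        rw [Module.mem_annihilator]
        intro m
        obtain ⟨a, rfl⟩ := Submodule.Quotient.mk_surjective _ m
        rw [← Submodule.Quotient.mk_smul, Submodule.Quotient.mk_eq_zero, Ideal.smul_top_eq_map,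
          Submodule.restrictScalars_mem, Ideal.map_ofList, Algebra.smul_def]
        exact Ideal.mul_mem_right _ _ (Ideal.Quotient.eq_zero_iff_mem.1 hs)
      have h1 : ringKrullDim (S ⧸ p.asIdeal) ≤ 0 := by
        refine (ringKrullDim_le_of_surjective _ (Ideal.Quotient.factor_surjective hkerφ)).trans ?_
        rw [ringKrullDim_eq_of_ringEquiv (RingHom.quotientKerEquivOfSurjective hφ)]
        -- `hD` reads `D + rs'.length = rs'.length`; cancelling in `WithBot ℕ∞` requires excluding
        -- `D = ⊤` first.
        revert hD
        generalize ringKrullDim (A ⧸ Ideal.ofList (rs'.map (algebraMap S A))) = D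
        intro hD
        induction D with
        | bot => exact bot_le
        | coe D =>
          induction D with
          | top => exact absurd hD (by
              rw [← WithBot.coe_natCast, ← WithBot.coe_add, top_add]
              exact fun h => ENat.top_ne_natCast _ (WithBot.coe_injective h))
          | coe D =>
            norm_cast at hD ⊢
            omega
      have h2 : Ring.KrullDimLE 0 (S ⧸ p.asIdeal) := by
        rwa [Ring.krullDimLE_iff]
      have h3 : (⊥ : Ideal (S ⧸ p.asIdeal)).IsMaximal :=
        Ring.krullDimLE_zero_iff.1 h2 ⊥ Ideal.isPrime_bot
      rw [Ideal.bot_quotient_isMaximal_iff] at h3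
      rw [PrimeSpectrum.mem_zeroLocus, IsLocalRing.eq_maximalIdeal h3])
  have hkd : (k : WithBot ℕ∞) ≤ rs'.length := by
    rw [hdim]
    refine hkS.trans ?_
    refine (ringKrullDim_le_of_surjective _ (Ideal.Quotient.factor_surjective hker)).trans ?_
    rw [ringKrullDim_eq_of_ringEquiv (RingHom.quotientKerEquivOfSurjective hsurj)]
  rw [hk] at hle
  have hpd' : projectiveDimension (ModuleCat.of S A) + rs'.length ≤ (k + 2 : ℕ) := hpd.ge.trans hle
  revert hpd'
  generalize projectiveDimension (ModuleCat.of S A) = D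
  intro hD
  induction D with
  | bot => exact bot_le
  | coe D =>
    induction D with
    | top => exact absurd hD (by
        rw [← WithBot.coe_natCast, ← WithBot.coe_natCast, ← WithBot.coe_add, top_add,
          WithBot.coe_le_coe]
        simp)
    | coe D =>
      have hD' : D + rs'.length ≤ k + 2 := by
        rw [WithBot.coe_natCast, ← Nat.cast_add, Nat.cast_le] at hD
        exact hD
      have hkd' : k ≤ rs'.length := by exact_mod_cast hkd
      have : D ≤ 2 := by omega
      rw [WithBot.coe_natCast]
      exact_mod_cast this

end LocalAlgebra

/-! ### Vanishing of the third differential, first locally and then by localization. -/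

section LocalizedResolution

open RingTheory.Sequence IsLocalRing CategoryTheory

universe u

/-- The kernel of a surjection from a free module onto a module of projective
dimension at most `k + 1` has projective dimension at most `k`. -/
theorem hasProjectiveDimensionLT_ker {S : Type u} [CommRing S] {F M : Type u} [AddCommGroup F]
    [Module S F] [Module.Free S F] [AddCommGroup M] [Module S M] {f : F →ₗ[S] M}
    (hf : Function.Surjective f) {k : ℕ} (h : HasProjectiveDimensionLT (ModuleCat.of S M) (k + 2)) :
    HasProjectiveDimensionLT (ModuleCat.of S (LinearMap.ker f)) (k + 1) :=
  ((LinearMap.shortExact_shortComplexKer hf).hasProjectiveDimensionLT_X₃_iff k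
    ((IsProjective.iff_projective F).1 inferInstance)).1 h

/-- The second syzygy map vanishes in a minimal free resolution of a module of projective dimension
at most two over a local ring. -/
theorem eq_zero_of_projectiveDimension_le_two {S : Type u} [CommRing S] [IsLocalRing S]
    [IsNoetherianRing S] {A F₀ F₁ F₃ : Type u} {r : ℕ}
    [AddCommGroup A] [Module S A] [AddCommGroup F₀] [Module S F₀] [Module.Free S F₀]
    [AddCommGroup F₁] [Module S F₁] [Module.Free S F₁] [AddCommGroup F₃] [Module S F₃]
    (hA : projectiveDimension (ModuleCat.of S A) ≤ 2)
    {π : F₀ →ₗ[S] A} (hπ : Function.Surjective π)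
    {δ₀ : F₁ →ₗ[S] F₀} (h₀ : Function.Exact δ₀ π)
    {δ₁ : (Fin r → S) →ₗ[S] F₁} (h₁ : Function.Exact δ₁ δ₀)
    {δ₂ : F₃ →ₗ[S] (Fin r → S)} (h₂ : Function.Exact δ₂ δ₁)
    (hmin : ∀ v a, δ₂ v a ∈ maximalIdeal S) : δ₂ = 0 := by
  -- The bound is strict: `LT 3` encodes dimension at most two. Two syzygy steps lower it to `LT 1`,
  -- that is, projective.
  have e2 : HasProjectiveDimensionLT (ModuleCat.of S A) (1 + 2) :=
    (projectiveDimension_le_iff _ 2).1 hA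
  have e1 := hasProjectiveDimensionLT_ker hπ e2
  let φ₀ : F₁ →ₗ[S] LinearMap.ker π :=
    δ₀.codRestrict _ fun v => LinearMap.mem_ker.2 (h₀.apply_apply_eq_zero v)
  have hφ₀ : Function.Surjective φ₀ := fun ⟨y, hy⟩ => by
    obtain ⟨x, hx⟩ := (h₀ y).1 hy
    exact ⟨x, Subtype.ext hx⟩
  have hker₀ : ∀ v, φ₀ v = 0 ↔ δ₀ v = 0 := fun v => by
    rw [← Subtype.coe_inj]
    rfl
  have e0 := hasProjectiveDimensionLT_ker (k := 0) hφ₀ e1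
  rw [zero_add, ← projective_iff_hasProjectiveDimensionLT_one,
    ← IsProjective.iff_projective] at e0
  let φ₁ : (Fin r → S) →ₗ[S] LinearMap.ker φ₀ :=
    δ₁.codRestrict _ fun v => LinearMap.mem_ker.2 ((hker₀ _).2 (h₁.apply_apply_eq_zero v))
  have hφ₁ : Function.Surjective φ₁ := fun ⟨y, hy⟩ => by
    obtain ⟨x, hx⟩ := (h₁ y).1 ((hker₀ y).1 hy)
    exact ⟨x, Subtype.ext hx⟩
  -- The second syzygy module is projective, so `ker φ₁` is a direct summand with projection `ρ`. It
  -- is also the image of `δ₂`, hence inside the maximal ideal times the free module. Applying `ρ`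
  -- gives `N ⊆ 𝔪N`, and Nakayama applies.
  obtain ⟨s, hs⟩ := Module.projective_lifting_property φ₁ LinearMap.id hφ₁
  let N : Submodule S (Fin r → S) := LinearMap.ker φ₁
  let ρ : (Fin r → S) →ₗ[S] (Fin r → S) := LinearMap.id - s ∘ₗ φ₁
  have hρN : ∀ v, ρ v ∈ N := fun v => by
    have : φ₁ (s (φ₁ v)) = φ₁ v := LinearMap.congr_fun hs (φ₁ v)
    simp [N, ρ, LinearMap.mem_ker, this]
  have hρ : ∀ v ∈ N, ρ v = v := fun v hv => by
    have : φ₁ v = 0 := hv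
    simp [ρ, this]
  have hNδ : ∀ v, v ∈ N ↔ δ₁ v = 0 := fun v => by
    rw [LinearMap.mem_ker, ← Subtype.coe_inj]
    rfl
  have hle : N ≤ maximalIdeal S • N := by
    intro v hv
    obtain ⟨w, rfl⟩ := (h₂ v).1 ((hNδ v).1 hv)
    rw [← hρ _ hv, ← Finset.univ_sum_single (δ₂ w), map_sum]
    refine Submodule.sum_mem _ fun a _ => ?_
    have : Pi.single a (δ₂ w a) = δ₂ w a • (Pi.single a 1 : Fin r → S) := by
      rw [← Pi.single_smul, smul_eq_mul, mul_one]
    rw [this, map_smul]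
    exact Submodule.smul_mem_smul (hmin w a) (hρN _)
  have hN := Submodule.eq_bot_of_le_smul_of_le_jacobson_bot _ N (IsNoetherian.noetherian N) hle
    (maximalIdeal_le_jacobson _)
  ext1 w
  have : δ₂ w ∈ N := (hNδ _).2 (h₂.apply_apply_eq_zero w)
  rwa [hN, Submodule.mem_bot] at this

/-- Let `R / I` be Cohen-Macaulay at a maximal ideal generated by a regular sequence, and let `I`
be contained in a prime of height two. Then the second syzygy map of a free resolution of `R / I`
which is minimal at the maximal ideal vanishes. -/
theorem eq_zero_of_isCohenMacaulayLocal {R : Type u} [CommRing R] [IsDomain R]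
    [IsNoetherianRing R] [UniqueFactorizationMonoid R] {m : Ideal R} [hm : m.IsMaximal]
    {rs : List R} (hreg : IsWeaklyRegular R rs) (hrs : Ideal.ofList rs = m) (hlen : 2 ≤ rs.length)
    {I P : Ideal R} [hP : P.IsPrime] (hht : P.height = 2) (hIP : I ≤ P) (hPm : P ≤ m)
    {m' : Ideal (R ⧸ I)} [hm' : m'.IsMaximal] (hmm' : m'.comap (Ideal.Quotient.mk I) = m)
    (hCM : GradedAlg.IsCohenMacaulayLocal (Localization.AtPrime m'))
    {r₀ r₁ r₂ r₃ : ℕ} {π : (Fin r₀ → R) →ₗ[R] R ⧸ I} (hπ : Function.Surjective π)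
    {δ₀ : (Fin r₁ → R) →ₗ[R] (Fin r₀ → R)} (h₀ : Function.Exact δ₀ π)
    {δ₁ : (Fin r₂ → R) →ₗ[R] (Fin r₁ → R)} (h₁ : Function.Exact δ₁ δ₀)
    {δ₂ : (Fin r₃ → R) →ₗ[R] (Fin r₂ → R)} (h₂ : Function.Exact δ₂ δ₁)
    (hmin : ∀ b a, δ₂ (Pi.single b 1) a ∈ m) : δ₂ = 0 := by
  let S := Localization.AtPrime m
  let A := Localization.AtPrime m'
  have hunit : ∀ y : m.primeCompl, IsUnit (algebraMap R A y) := fun y => by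
    rw [IsScalarTower.algebraMap_apply R (R ⧸ I) A]
    refine IsLocalization.map_units A (⟨algebraMap R (R ⧸ I) y, fun h => y.2 ?_⟩ : m'.primeCompl)
    exact hmm'.le h
  let _ : Algebra S A := (IsLocalization.lift hunit : S →+* A).toAlgebra
  have hSA : (algebraMap S A : S →+* A) = IsLocalization.lift hunit := rfl
  have : IsScalarTower R S A := IsScalarTower.of_algebraMap_eq fun x => by
    rw [hSA]
    exact (IsLocalization.lift_eq hunit x).symm
  -- This identifies `A` with the localization at `m` of the `R`-module `R ⧸ I`, so that the
  -- localized complex resolves `A` over `S`.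
  have hsub : Algebra.algebraMapSubmonoid (R ⧸ I) m.primeCompl = m'.primeCompl := by
    ext t
    obtain ⟨x, rfl⟩ := Ideal.Quotient.mk_surjective t
    constructor
    · rintro ⟨y, hy, hyx⟩ hx
      refine hy ?_
      rw [← hyx] at hx
      change y ∈ m
      rw [← hmm']
      exact hx
    · intro hx
      refine ⟨x, fun h => hx ?_, rfl⟩
      change x ∈ m at h
      rwa [← hmm'] at h
  have hloc : IsLocalizedModule m.primeCompl (IsScalarTower.toAlgHom R (R ⧸ I) A).toLinearMap := by
    rw [isLocalizedModule_iff_isLocalization, hsub]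
    infer_instance
  have hsurj : Function.Surjective (algebraMap S A) := by
    intro z
    obtain ⟨⟨t, s⟩, hz⟩ := IsLocalization.surj m'.primeCompl z
    obtain ⟨x, rfl⟩ := Ideal.Quotient.mk_surjective t
    obtain ⟨y, hy⟩ := Ideal.Quotient.mk_surjective (s : R ⧸ I)
    have hym : y ∈ m.primeCompl := fun h => s.2 (by
      change y ∈ m at h
      rw [← hmm', Ideal.mem_comap, hy] at h
      exact h)
    refine ⟨IsLocalization.mk' S x ⟨y, hym⟩, ?_⟩
    rw [hSA, IsLocalization.lift_mk'_spec]
    rw [IsScalarTower.algebraMap_apply R (R ⧸ I) A, IsScalarTower.algebraMap_apply R (R ⧸ I) A]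
    simp only [Ideal.Quotient.algebraMap_eq, hy]
    rw [mul_comm, hz]
  have hdisj : Disjoint (m.primeCompl : Set R) P :=
    Set.disjoint_left.2 fun x hx hxP => hx (hPm hxP)
  have hPS : (P.map (algebraMap R S)).IsPrime :=
    IsLocalization.isPrime_of_isPrime_disjoint m.primeCompl S P hP hdisj
  have hhtS : (P.map (algebraMap R S)).height = 2 := by
    rw [IsLocalization.height_map_of_disjoint m.primeCompl P hdisj, hht]
  have hker : RingHom.ker (algebraMap S A) ≤ P.map (algebraMap R S) := by
    intro z hz
    obtain ⟨x, y, rfl⟩ := IsLocalization.exists_mk'_eq m.primeCompl z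
    rw [RingHom.mem_ker, hSA, IsLocalization.lift_mk'_spec, mul_zero,
      IsScalarTower.algebraMap_apply R (R ⧸ I) A,
      IsLocalization.map_eq_zero_iff m'.primeCompl A] at hz
    obtain ⟨⟨c, hc⟩, hcx⟩ := hz
    obtain ⟨c, rfl⟩ := Ideal.Quotient.mk_surjective c
    have hcm : c ∉ m := fun h => hc (by rwa [← hmm'] at h)
    have hmem : c * x ∈ I := by
      rw [← Ideal.Quotient.eq_zero_iff_mem, map_mul]
      exact hcx
    have hxP : x ∈ P := (hP.mem_or_mem (hIP hmem)).resolve_left fun h => hcm (hPm h)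
    rw [IsLocalization.mk'_eq_mul_mk'_one]
    exact Ideal.mul_mem_right _ _ (Ideal.mem_map_of_mem _ hxP)
  have hregS := IsWeaklyRegular.isRegular_of_isLocalization_of_mem S m hreg
    (fun r hr => hrs ▸ Ideal.subset_span hr)
  have hrsS : Ideal.ofList (rs.map (algebraMap R S)) = maximalIdeal S := by
    rw [← Ideal.map_ofList, hrs]
    exact Localization.AtPrime.map_eq_maximalIdeal
  have : IsDomain S := IsLocalization.isDomain_localization (Ideal.primeCompl_le_nonZeroDivisors m)
  have hpd := projectiveDimension_le_two_of_isCohenMacaulayLocal hregS hrsS (by simpa using hlen)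
    hhtS hsurj hker hCM
  let ι : ∀ r : ℕ, (Fin r → R) →ₗ[R] (Fin r → S) := fun r =>
    LinearMap.pi fun i => Algebra.linearMap R S ∘ₗ LinearMap.proj i
  have hι : ∀ r : ℕ, IsLocalizedModule m.primeCompl (ι r) := fun r => inferInstance
  let ιA : (R ⧸ I) →ₗ[R] A := (IsScalarTower.toAlgHom R (R ⧸ I) A).toLinearMap
  have hcoe : ∀ {M M' N N' : Type u} [AddCommGroup M] [Module R M] [AddCommGroup M']
      [Module R M'] [AddCommGroup N] [Module R N] [AddCommGroup N'] [Module R N'] [Module S M']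
      [Module S N'] [IsScalarTower R S M'] [IsScalarTower R S N'] (f : M →ₗ[R] M')
      [IsLocalizedModule m.primeCompl f] (g : N →ₗ[R] N') [IsLocalizedModule m.primeCompl g]
      (x : M →ₗ[R] N), (⇑(IsLocalizedModule.mapExtendScalars m.primeCompl f g S x) : M' → N') =
        IsLocalizedModule.map m.primeCompl f g x := fun f _ g _ x => by
    ext
    simp
  let δ₂' := IsLocalizedModule.mapExtendScalars m.primeCompl (ι r₃) (ι r₂) S δ₂
  have hδ₂' : ∀ v, δ₂' (ι r₃ v) = ι r₂ (δ₂ v) := fun v => by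
    simp only [δ₂', IsLocalizedModule.mapExtendScalars_apply_apply, IsLocalizedModule.map_apply]
  have hzero : δ₂' = 0 := by
    refine eq_zero_of_projectiveDimension_le_two hpd
      (π := IsLocalizedModule.mapExtendScalars m.primeCompl (ι r₀) ιA S π) ?_
      (δ₀ := IsLocalizedModule.mapExtendScalars m.primeCompl (ι r₁) (ι r₀) S δ₀) ?_
      (δ₁ := IsLocalizedModule.mapExtendScalars m.primeCompl (ι r₂) (ι r₁) S δ₁) ?_ ?_ ?_
    · rw [hcoe]
      exact IsLocalizedModule.map_surjective _ _ _ _ hπ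
    · rw [hcoe, hcoe]
      exact IsLocalizedModule.map_exact _ _ _ _ _ _ h₀
    · rw [hcoe, hcoe]
      exact IsLocalizedModule.map_exact _ _ _ _ _ _ h₁
    · rw [hcoe, hcoe]
      exact IsLocalizedModule.map_exact _ _ _ _ _ _ h₂
    · intro v a
      rw [← Finset.univ_sum_single v, map_sum, Finset.sum_apply]
      refine Ideal.sum_mem _ fun b _ => ?_
      have : (Pi.single b (v b) : Fin r₃ → S) = v b • ι r₃ (Pi.single b 1) := by
        ext c
        by_cases hc : c = b
        · subst hc
          simp [ι]
        · simp [ι, hc]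
      rw [this, map_smul, hδ₂']
      refine Ideal.mul_mem_left _ _ ?_
      rw [← Localization.AtPrime.map_eq_maximalIdeal]
      exact Ideal.mem_map_of_mem _ (hmin b a)
  -- Over a domain, free modules embed in their localizations, so the vanishing of `δ₂'` descends to
  -- `δ₂`.
  have hinj : Function.Injective (ι r₂) := fun v w h => by
    ext a
    exact IsLocalization.injective S (Ideal.primeCompl_le_nonZeroDivisors m) (congrFun h a)
  refine LinearMap.ext fun v => hinj ?_
  rw [← hδ₂', hzero, LinearMap.zero_apply, LinearMap.zero_apply, map_zero]

end LocalizedResolution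

/-! ### The irrelevant ideal and the length of the minimal resolution. -/

namespace GradedAlg

open MvPolynomial

section Irrelevant

open RingTheory.Sequence

variable {K : Type*} [Field K] {n : ℕ}

theorem ker_constantCoeff_eq_idealOfVars :
    RingHom.ker (constantCoeff : MvPolynomial (Fin n) K →+* K) = idealOfVars (Fin n) K := by
  apply le_antisymm
  · exact fun p hp => mem_idealOfVars_of_constantCoeff hp
  · rw [Ideal.span_le]
    rintro _ ⟨i, rfl⟩
    simp

theorem mem_idealOfVars_iff {p : MvPolynomial (Fin n) K} :
    p ∈ idealOfVars (Fin n) K ↔ constantCoeff p = 0 := by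
  rw [← ker_constantCoeff_eq_idealOfVars, RingHom.mem_ker]

theorem isMaximal_idealOfVars : (idealOfVars (Fin n) K).IsMaximal := by
  rw [← ker_constantCoeff_eq_idealOfVars]
  exact RingHom.ker_isMaximal_of_surjective _ fun a => ⟨C a, constantCoeff_C _ a⟩

theorem ofList_ofFn_X :
    Ideal.ofList (List.ofFn (X : Fin n → MvPolynomial (Fin n) K)) = idealOfVars (Fin n) K := by
  simp only [Ideal.ofList, List.mem_ofFn]
  rfl

/-- The variables form a regular sequence. -/
theorem isWeaklyRegular_ofFn_X :
    IsWeaklyRegular (MvPolynomial (Fin n) K) (List.ofFn (X : Fin n → MvPolynomial (Fin n) K)) := by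
  rw [isWeaklyRegular_iff_Fin]
  rintro ⟨i, hi⟩
  have hin : i < n := by simpa using hi
  have hspan : Ideal.ofList (List.take i (List.ofFn (X : Fin n → MvPolynomial (Fin n) K))) •
      (⊤ : Submodule (MvPolynomial (Fin n) K) (MvPolynomial (Fin n) K)) =
      Ideal.span (X '' {j : Fin n | (j : ℕ) < i}) := by
    rw [smul_eq_mul, Ideal.mul_top, Ideal.ofList]
    congr 1
    ext p
    simp only [Set.mem_ofPred_eq, List.mem_take_iff_getElem, List.getElem_ofFn, List.length_ofFn,
      Set.mem_image]
    constructor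
    · rintro ⟨j, hj, rfl⟩
      exact ⟨⟨j, by omega⟩, by simp; omega, rfl⟩
    · rintro ⟨j, hj, rfl⟩
      exact ⟨j, by omega, rfl⟩
  rw [isSMulRegular_quotient_iff_mem_of_smul_mem, hspan]
  intro p hp
  simp only [Fin.getElem_fin, List.getElem_ofFn, smul_eq_mul] at hp
  rw [mem_ideal_span_X_image] at hp ⊢
  intro s hs
  obtain ⟨j, hj, hsj⟩ := hp (s + Finsupp.single ⟨i, hin⟩ 1) (by
    rw [mem_support_iff, mul_comm, coeff_mul_X]
    exact mem_support_iff.1 hs)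
  refine ⟨j, hj, ?_⟩
  have hne : (⟨i, hin⟩ : Fin n) ≠ j := by
    rintro rfl
    exact absurd hj (lt_irrefl i)
  rwa [Finsupp.add_apply, Finsupp.single_eq_of_ne' hne, add_zero] at hsj

theorem componentInt_zero (p : MvPolynomial (Fin n) K) :
    componentInt 0 p = C (constantCoeff p) := by
  ext t
  simp only [coeff_componentInt, coeff_C, constantCoeff_eq]
  by_cases ht : t = 0
  · simp [ht]
  · have h3 : t.degree ≠ 0 := by rwa [Ne, Finsupp.degree_eq_zero_iff]
    rw [if_neg (by exact_mod_cast h3), if_neg (fun h => ht h.symm)]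

theorem IsGradedIdeal.le_idealOfVars {I : Ideal (MvPolynomial (Fin n) K)} (hI : IsGradedIdeal I)
    (hI' : I ≠ ⊤) : I ≤ idealOfVars (Fin n) K := by
  intro p hp
  rw [mem_idealOfVars_iff]
  by_contra hc
  have h1 := hI.componentInt_mem hp 0
  rw [componentInt_zero] at h1
  exact hI' (Ideal.eq_top_of_isUnit_mem _ h1 ((IsUnit.mk0 _ hc).map C))

/-- The minimal primes of a graded ideal are contained in the irrelevant ideal. -/
theorem IsGradedIdeal.minimalPrimes_le_idealOfVars {I : Ideal (MvPolynomial (Fin n) K)}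
    (hI : IsGradedIdeal I) {P : Ideal (MvPolynomial (Fin n) K)} (hP : P ∈ I.minimalPrimes) :
    P ≤ idealOfVars (Fin n) K := by
  let _ : GradedAlgebra (homogeneousSubmodule (Fin n) K) := MvPolynomial.gradedAlgebra
  have hPp : P.IsPrime := hP.isPrime
  -- The homogeneous core of a prime is prime and still contains the graded ideal `I`; minimality of
  -- `P` makes the two equal.
  let Q := P.homogeneousCore (homogeneousSubmodule (Fin n) K)
  have hQ : Q.toIdeal ≤ P := Ideal.toIdeal_homogeneousCore_le _ _
  have hIQ : I ≤ Q.toIdeal := by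
    have := Ideal.homogeneousCore_mono (homogeneousSubmodule (Fin n) K) hP.1.2
    rw [← Ideal.IsHomogeneous.toIdeal_homogeneousCore_eq_self hI]
    exact this
  have hQp : Q.toIdeal.IsPrime := Ideal.IsPrime.homogeneousCore hPp
  have hPQ : P ≤ Q.toIdeal := hP.2 ⟨hQp, hIQ⟩ hQ
  have hPg : IsGradedIdeal Q.toIdeal := Q.isHomogeneous
  exact hPQ.trans (hPg.le_idealOfVars hQp.ne_top)

theorem le_of_height_eq_two {I : Ideal (MvPolynomial (Fin n) K)} (h : I.height = 2) : 2 ≤ n := by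
  obtain ⟨P, hP, -, hht⟩ := Ideal.exists_isPrime_height_eq (n := 2) h
  have h1 := P.height_le_ringKrullDim_of_isPrime
  rw [hht, MvPolynomial.ringKrullDim_of_isNoetherianRing, ringKrullDim_eq_zero_of_field,
    zero_add, Nat.card_fin] at h1
  exact_mod_cast h1

end Irrelevant

namespace MinimalGradedFreeResolution

variable {K : Type*} [Field K] {n : ℕ} {I : Ideal (MvPolynomial (Fin n) K)}
  (F : MinimalGradedFreeResolution I)

theorem constantCoeff_d (i : ℕ) (v) (a) : constantCoeff (F.d i v a) = 0 := by
  rw [← mem_idealOfVars_iff, ← Finset.univ_sum_single v, map_sum, Finset.sum_apply]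
  refine Ideal.sum_mem _ fun b _ => ?_
  have : (Pi.single b (v b) : Fin (F.rank (i + 1)) → MvPolynomial (Fin n) K) =
      v b • Pi.single b 1 := by
    rw [← Pi.single_smul, smul_eq_mul, mul_one]
  rw [this, map_smul]
  exact Ideal.mul_mem_left _ _ (F.minimal i b a)

/-- Minimality in usable form: entries in the image have no constant term. Hence a zero differential
leaves no basis vector in the next module, and no generator of `I` in the resolution is zero. -/
theorem single_notMem_range_d (i : ℕ) (a : Fin (F.rank i)) :
    Pi.single a 1 ∉ LinearMap.range (F.d i) := by
  rintro ⟨v, hv⟩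
  have := F.constantCoeff_d i v a
  rw [hv] at this
  simp at this

theorem rank_eq_zero_of_d_eq_zero {i : ℕ} (h : F.d i = 0) : F.rank (i + 1) = 0 := by
  by_contra h0
  refine F.single_notMem_range_d (i + 1) ⟨0, Nat.pos_of_ne_zero h0⟩ ?_
  exact ((F.exact i) _).1 (by rw [h]; rfl)

theorem d_eq_zero_of_rank_eq_zero {i : ℕ} (h : F.rank i = 0) : F.d i = 0 := by
  have : IsEmpty (Fin (F.rank i)) := by
    rw [h]
    infer_instance
  exact LinearMap.ext fun v => Subsingleton.elim _ _

theorem unique_rank_zero : Nonempty (Unique (Fin (F.rank 0))) := by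
  rw [F.rank_zero]
  exact ⟨inferInstance⟩

/-- The augmentation `F₀ = R → R / I`. -/
noncomputable def augmentation :
    (Fin (F.rank 0) → MvPolynomial (Fin n) K) →ₗ[MvPolynomial (Fin n) K]
      MvPolynomial (Fin n) K ⧸ I :=
  ∑ a, (Submodule.mkQ I) ∘ₗ LinearMap.proj a

theorem augmentation_surjective : Function.Surjective F.augmentation := by
  obtain ⟨_⟩ := F.unique_rank_zero
  intro y
  obtain ⟨x, rfl⟩ := Submodule.Quotient.mk_surjective _ y
  exact ⟨fun _ => x, by simp [augmentation]⟩

theorem exact_augmentation : Function.Exact (F.d 0) F.augmentation := by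
  obtain ⟨_⟩ := F.unique_rank_zero
  intro v
  have := F.range_zero v
  rw [LinearMap.mem_range] at this
  rw [Set.mem_range, this]
  simp only [augmentation, Finset.univ_unique, Finset.sum_singleton, LinearMap.comp_apply,
    LinearMap.proj_apply, Submodule.mkQ_apply, Submodule.Quotient.mk_eq_zero]
  exact ⟨fun h a => by rwa [Subsingleton.elim a default], fun h => h _⟩

/-- A codimension two Cohen-Macaulay ideal has a minimal resolution of length two. -/
theorem d_two_eq_zero (hI : IsGradedIdeal I) (hcodim : I.height = 2)
    (hCM : IsCohenMacaulayRing (MvPolynomial (Fin n) K ⧸ I)) : F.d 2 = 0 := by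
  obtain ⟨P, hP, hIP, hht⟩ := Ideal.exists_isPrime_height_eq (n := 2) hcodim
  have hPmin : P ∈ I.minimalPrimes := Ideal.mem_minimalPrimes_of_height_le hIP
    (by rw [hht, hcodim]; rfl)
  have hPm := hI.minimalPrimes_le_idealOfVars hPmin
  have hmax := isMaximal_idealOfVars (K := K) (n := n)
  have hker : RingHom.ker (Ideal.Quotient.mk I) ≤ idealOfVars (Fin n) K := by
    rw [Ideal.mk_ker]
    exact hIP.trans hPm
  have hcomap : ((idealOfVars (Fin n) K).map (Ideal.Quotient.mk I)).comap (Ideal.Quotient.mk I) =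
      idealOfVars (Fin n) K := by
    rw [Ideal.comap_map_of_surjective _ Ideal.Quotient.mk_surjective]
    exact sup_eq_left.2 hker
  have hm' : ((idealOfVars (Fin n) K).map (Ideal.Quotient.mk I)).IsMaximal :=
    Ideal.IsMaximal.map_of_surjective_of_ker_le Ideal.Quotient.mk_surjective hker
  exact eq_zero_of_isCohenMacaulayLocal isWeaklyRegular_ofFn_X ofList_ofFn_X
    (by simpa using le_of_height_eq_two hcodim)
    hht hIP hPm hcomap (hCM.localization _) F.augmentation_surjective F.exact_augmentation
    (F.exact 0) (F.exact 1) (F.minimal 2)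

theorem rank_eq_zero_of_three_le (h : F.d 2 = 0) {i : ℕ} (hi : 3 ≤ i) : F.rank i = 0 := by
  induction i, hi using Nat.le_induction with
  | base => exact F.rank_eq_zero_of_d_eq_zero h
  | succ i hi ih =>
    exact F.rank_eq_zero_of_d_eq_zero (F.d_eq_zero_of_rank_eq_zero ih)

theorem d_one_injective (h : F.d 2 = 0) : Function.Injective (F.d 1) := by
  rw [injective_iff_map_eq_zero]
  intro v hv
  obtain ⟨w, rfl⟩ := (F.exact 1 v).1 hv
  rw [h, LinearMap.zero_apply]

end MinimalGradedFreeResolution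

end GradedAlg

/-! ### The Hilbert–Burch theorem over a factorial domain. -/

section HilbertBurch

open Matrix

/-- The square matrix obtained by adjoining the column `w` to `φ`. -/
def adjoinCol {ι A : Type*} {s : ℕ} (e : Fin (s + 1) ≃ ι) (φ : Matrix ι (Fin s) A) (w : ι → A) :
    Matrix ι ι A :=
  Matrix.of fun i j => (Fin.cons (w i) (φ i) : Fin (s + 1) → A) (e.symm j)

theorem adjoinCol_apply {ι A : Type*} {s : ℕ} (e : Fin (s + 1) ≃ ι) (φ : Matrix ι (Fin s) A)
    (w : ι → A) (i : ι) (t : Fin (s + 1)) :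
    adjoinCol e φ w i (e t) = (Fin.cons (w i) (φ i) : Fin (s + 1) → A) t := by
  simp [adjoinCol]

variable {ι : Type*} [Fintype ι]

/-- The rank of a codimension-one-kernel presentation over a Noetherian domain. -/
theorem card_eq_card_add_one_of_exact {κ A : Type*} [Fintype κ] [CommRing A] [IsDomain A]
    [IsNoetherianRing A] {φ : (κ → A) →ₗ[A] (ι → A)} {f : (ι → A) →ₗ[A] A}
    (hφ : Function.Injective φ) (hφf : Function.Exact φ f) (hf : f ≠ 0) :
    Fintype.card ι = Fintype.card κ + 1 := by
  have h1 := Submodule.finrank_quotient_add_finrank (LinearMap.ker f)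
  rw [LinearEquiv.finrank_eq f.quotKerEquivRange, (LinearMap.exact_iff.1 hφf),
    LinearMap.finrank_range_of_inj hφ, Module.finrank_pi, Module.finrank_pi] at h1
  -- The image of `f` is a nonzero ideal of a domain, so it has rank exactly one.
  have h2 : Module.finrank A (LinearMap.range f) ≤ 1 := by
    simpa using Submodule.finrank_le (LinearMap.range f)
  have h3 : Module.finrank A (LinearMap.range f) ≠ 0 := by
    rw [Ne, Submodule.finrank_eq_zero, LinearMap.range_eq_bot]
    exact hf
  omega

variable [DecidableEq ι] {s : ℕ} (e : Fin (s + 1) ≃ ι)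

/-- The `s` columns are independent in a free module of rank `s + 1`, so one more independent column
can be added. This is used both over `R` and over `R/(q)`. -/
theorem exists_det_adjoinCol_ne_zero {A : Type*} [CommRing A] [IsDomain A]
    {φ : Matrix ι (Fin s) A} (hφ : ∀ v, φ *ᵥ v = 0 → v = 0) :
    ∃ w, (adjoinCol e φ w).det ≠ 0 := by
  have hli : LinearIndependent A (fun k => fun i => φ i k) := by
    rw [Fintype.linearIndependent_iff]
    intro g hg
    have := hφ g (by
      ext i
      have := congrFun hg i
      simpa [Matrix.mulVec, dotProduct, mul_comm] using this)
    exact congrFun this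
  have hlt : s < Module.finrank A (ι → A) := by
    rw [Module.finrank_pi, ← Fintype.card_congr e, Fintype.card_fin]
    exact Nat.lt_succ_self s
  obtain ⟨w, hw⟩ := exists_linearIndependent_cons_of_lt_finrank hli hlt
  refine ⟨w, fun h => ?_⟩
  obtain ⟨c, hc, hcw⟩ := Matrix.exists_mulVec_eq_zero_iff.2 h
  rw [Fintype.linearIndependent_iff] at hw
  have h0 := hw (fun t => c (e t)) (by
    ext i
    have h1 := congrFun hcw i
    rw [Matrix.mulVec, dotProduct, ← e.sum_comp, Fin.sum_univ_succ] at h1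
    simp only [adjoinCol_apply, Fin.cons_zero, Fin.cons_succ] at h1
    rw [Fin.sum_univ_succ]
    simp only [Fin.cons_zero, Fin.cons_succ, Pi.add_apply, Finset.sum_apply, Pi.smul_apply,
      smul_eq_mul]
    simpa [mul_comm] using h1)
  exact hc (funext fun i => by simpa using h0 (e.symm i))

/-- `w ↦ det [w | φ]` as a linear map. -/
noncomputable def detAdjoinCol {A : Type*} [CommRing A] (φ : Matrix ι (Fin s) A) :
    (ι → A) →ₗ[A] A :=
  LinearMap.proj (e 0) ∘ₗ (adjoinCol e φ 0).cramer

theorem detAdjoinCol_apply {A : Type*} [CommRing A] (φ : Matrix ι (Fin s) A) (w : ι → A) :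
    detAdjoinCol e φ w = (adjoinCol e φ w).det := by
  rw [detAdjoinCol, LinearMap.comp_apply, LinearMap.proj_apply, Matrix.cramer_apply]
  congr 1
  ext i j
  obtain ⟨t, rfl⟩ := e.surjective j
  refine Fin.cases ?_ (fun k => ?_) t
  · rw [Matrix.updateCol_self, adjoinCol_apply, Fin.cons_zero]
  · rw [Matrix.updateCol_ne (by simp), adjoinCol_apply, adjoinCol_apply,
      Fin.cons_succ, Fin.cons_succ]

theorem detAdjoinCol_mulVec {A : Type*} [CommRing A] (φ : Matrix ι (Fin s) A) (v : Fin s → A) :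
    detAdjoinCol e φ (φ *ᵥ v) = 0 := by
  have h1 : φ *ᵥ v = ∑ k, v k • fun i => φ i k := by
    ext i
    simp [Matrix.mulVec, dotProduct, mul_comm]
  rw [h1, map_sum]
  refine Finset.sum_eq_zero fun k _ => ?_
  rw [map_smul, detAdjoinCol_apply, Matrix.det_zero_of_column_eq (i := e 0) (j := e k.succ),
    smul_zero]
  · simp [Fin.succ_ne_zero, eq_comm]
  · intro i
    rw [adjoinCol_apply, adjoinCol_apply, Fin.cons_zero, Fin.cons_succ]

/-- **Hilbert–Burch**: in a codimension two resolution of length two the generators are, up to a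
unit, the maximal minors of the matrix of relations. -/
theorem exists_isUnit_det_adjoinCol_eq {R : Type*} [CommRing R] [IsDomain R]
    [UniqueFactorizationMonoid R] {φ : Matrix ι (Fin s) R} {f : (ι → R) →ₗ[R] R}
    (hφ : ∀ v, φ *ᵥ v = 0 → v = 0) (hφf : ∀ w, f w = 0 ↔ ∃ v, φ *ᵥ v = w)
    (hf : f ≠ 0) (hgcd : ∀ p, Prime p → ∃ i, ¬ p ∣ f (Pi.single i 1)) :
    ∃ c, IsUnit c ∧ ∀ w, (adjoinCol e φ w).det = c * f w := by
  let D := detAdjoinCol e φ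
  have hD : ∀ w, f w = 0 → D w = 0 := fun w hw => by
    obtain ⟨v, rfl⟩ := (hφf w).1 hw
    exact detAdjoinCol_mulVec e φ v
  -- `D` vanishes on `ker f`, so `D` and `f` are proportional over the fraction field. Writing the
  -- ratio in lowest terms, its denominator divides every value of `f` and is therefore a unit.
  have hcross : ∀ w w', f w * D w' = f w' * D w := fun w w' => by
    have := hD (f w • w' - f w' • w) (by simp [mul_comm])
    rw [map_sub, map_smul, map_smul, sub_eq_zero] at this
    exact this
  obtain ⟨w₀, hw₀⟩ : ∃ w, f w ≠ 0 := by
    by_contra! h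
    exact hf (LinearMap.ext h)
  obtain ⟨a, b, c', hab, ha, hb⟩ :=
    UniqueFactorizationMonoid.exists_reduced_factors (f w₀) hw₀ (D w₀)
  have hc' : c' ≠ 0 := by
    rintro rfl
    exact hw₀ (by rw [← ha, zero_mul])
  have ha0 : a ≠ 0 := by
    rintro rfl
    exact hw₀ (by rw [← ha, mul_zero])
  have hadvd : ∀ w, a ∣ f w := fun w => by
    refine hab.dvd_of_dvd_mul_right (y := f w) ⟨D w, ?_⟩
    have h1 := hcross w₀ w
    rw [← ha, ← hb] at h1
    apply mul_left_cancel₀ hc'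
    linear_combination -h1
  have haunit : IsUnit a := by
    by_contra hau
    obtain ⟨p, hp, hpa⟩ := WfDvdMonoid.exists_irreducible_factor hau ha0
    obtain ⟨i, hi⟩ := hgcd p (UniqueFactorizationMonoid.irreducible_iff_prime.1 hp)
    exact hi (hpa.trans (hadvd _))
  obtain ⟨u, rfl⟩ := haunit
  let c := b * (↑u⁻¹ : R)
  have hc : ∀ w, D w = c * f w := fun w => by
    have h1 := hcross w₀ w
    rw [← ha, ← hb] at h1
    have h2 : (u : R) * D w = f w * b := by
      apply mul_left_cancel₀ hc'
      linear_combination h1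
    have h3 : (↑u⁻¹ : R) * u = 1 := u.inv_mul
    calc D w = (↑u⁻¹ : R) * (u * D w) := by rw [← mul_assoc, h3, one_mul]
      _ = c * f w := by rw [h2]; ring
  simp only [D, detAdjoinCol_apply] at hc
  refine ⟨c, ?_, hc⟩
  by_contra hcu
  have hc0 : c ≠ 0 := fun h => by
    obtain ⟨w, hw⟩ := exists_det_adjoinCol_ne_zero e hφ
    exact hw (by rw [hc, h, zero_mul])
  obtain ⟨q, hq, hqc⟩ := WfDvdMonoid.exists_irreducible_factor hcu hc0
  have hqp : Prime q := UniqueFactorizationMonoid.irreducible_iff_prime.1 hq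
  have hqI : (Ideal.span {q}).IsPrime := (Ideal.span_singleton_prime hqp.ne_zero).2 hqp
  let mk := Ideal.Quotient.mk (Ideal.span {q})
  have hmk : ∀ x, mk x = 0 ↔ q ∣ x := fun x => by
    rw [Ideal.Quotient.eq_zero_iff_mem, Ideal.mem_span_singleton]
  -- If a prime `q` divides `c`, all maximal minors vanish modulo `q`, so `φ` has a kernel vector
  -- modulo `q`. A lift `v'` satisfies `φ v' = q w` with `f w = 0`, so `w = φ z`. Injectivity then
  -- gives `v' = q z`, contradicting `v ≠ 0`.
  have hex : ∃ v : Fin s → R ⧸ Ideal.span {q}, φ.map mk *ᵥ v = 0 ∧ v ≠ 0 := by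
    by_contra! h
    obtain ⟨w, hw⟩ := exists_det_adjoinCol_ne_zero e h
    choose w' hw' using fun i => Ideal.Quotient.mk_surjective (w i)
    apply hw
    have : adjoinCol e (φ.map mk) w = mk.mapMatrix (adjoinCol e φ w') := by
      ext i j
      obtain ⟨t, rfl⟩ := e.surjective j
      rw [RingHom.mapMatrix_apply, Matrix.map_apply, adjoinCol_apply, adjoinCol_apply]
      refine Fin.cases ?_ (fun k => ?_) t
      · rw [Fin.cons_zero, Fin.cons_zero, hw']
      · rw [Fin.cons_succ, Fin.cons_succ, Matrix.map_apply]
    rw [this, ← RingHom.map_det, hmk, hc]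
    exact hqc.mul_right _
  obtain ⟨v, hv, hv0⟩ := hex
  choose v' hv' using fun i => Ideal.Quotient.mk_surjective (v i)
  have hdvd : ∀ i, q ∣ (φ *ᵥ v') i := fun i => by
    rw [← hmk]
    have := congrFun hv i
    simp only [Matrix.mulVec, dotProduct, Matrix.map_apply, Pi.zero_apply] at this ⊢
    rw [map_sum, ← this]
    exact Finset.sum_congr rfl fun k _ => by rw [map_mul, hv']
  choose w hw using hdvd
  have hw' : φ *ᵥ v' = q • w := funext hw
  have h1 : f w = 0 := by
    have := (hφf (φ *ᵥ v')).2 ⟨v', rfl⟩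
    rw [hw', map_smul, smul_eq_mul] at this
    exact (mul_eq_zero.1 this).resolve_left hqp.ne_zero
  obtain ⟨z, hz⟩ := (hφf w).1 h1
  have h2 : v' - q • z = 0 := hφ _ (by
    rw [Matrix.mulVec_sub, Matrix.mulVec_smul, hz, hw', sub_self])
  apply hv0
  ext k
  rw [← hv', Pi.zero_apply]
  change mk (v' k) = 0
  rw [hmk]
  exact ⟨z k, congrFun (sub_eq_zero.1 h2) k⟩

end HilbertBurch

/-! ### Degrees of the entries and minors of the relation matrix. -/

namespace GradedAlg

open MvPolynomial

section

variable {K : Type*} [Field K] {n : ℕ}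

theorem IsHomogeneousInt.sum {α : Type*} {T : Finset α} {p : α → MvPolynomial (Fin n) K} {k : ℤ}
    (h : ∀ x ∈ T, IsHomogeneousInt (p x) k) : IsHomogeneousInt (∑ x ∈ T, p x) k := by
  classical
  intro s hs
  obtain ⟨x, hx, hs⟩ := Finset.mem_biUnion.1 (support_sum hs)
  exact h x hx s hs

theorem IsHomogeneousInt.mul {p q : MvPolynomial (Fin n) K} {k l : ℤ}
    (hp : IsHomogeneousInt p k) (hq : IsHomogeneousInt q l) : IsHomogeneousInt (p * q) (k + l) := by
  classical
  intro s hs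
  obtain ⟨x, hx, y, hy, rfl⟩ := Finset.mem_add.1 (support_mul p q hs)
  rw [map_add, Nat.cast_add, hp x hx, hq y hy]

theorem isHomogeneousInt_C (c : K) : IsHomogeneousInt (C c : MvPolynomial (Fin n) K) 0 := by
  intro s hs
  rw [mem_support_iff, coeff_C] at hs
  have : s = 0 := by
    by_contra h
    exact hs (if_neg fun h' => h h'.symm)
  simp [this]

theorem IsHomogeneousInt.prod {α : Type*} {T : Finset α} {p : α → MvPolynomial (Fin n) K}
    {k : α → ℤ} (h : ∀ x ∈ T, IsHomogeneousInt (p x) (k x)) :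
    IsHomogeneousInt (∏ x ∈ T, p x) (∑ x ∈ T, k x) := by
  classical
  induction T using Finset.induction_on with
  | empty =>
    rw [Finset.prod_empty, Finset.sum_empty]
    exact isHomogeneousInt_C 1
  | insert x T hx ih =>
    rw [Finset.prod_insert hx, Finset.sum_insert hx]
    exact (h x (Finset.mem_insert_self x T)).mul
      (ih fun y hy => h y (Finset.mem_insert_of_mem hy))

/-- The determinant of a matrix whose `(i, j)` entry is homogeneous of degree `b j - a i`. -/
theorem IsHomogeneousInt.det {ι : Type*} [Fintype ι] [DecidableEq ι]
    {M : Matrix ι ι (MvPolynomial (Fin n) K)} {a b : ι → ℤ}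
    (h : ∀ i j, IsHomogeneousInt (M i j) (b j - a i)) :
    IsHomogeneousInt M.det (∑ j, b j - ∑ i, a i) := by
  rw [Matrix.det_apply']
  refine IsHomogeneousInt.sum fun σ _ => ?_
  have h1 : IsHomogeneousInt (∏ j, M (σ j) j) (∑ j, b j - ∑ i, a i) := by
    rw [← Equiv.sum_comp σ a, ← Finset.sum_sub_distrib]
    exact IsHomogeneousInt.prod fun j _ => h _ _
  have h2 := (isHomogeneousInt_C (n := n) (((Equiv.Perm.sign σ : ℤˣ) : ℤ) : K)).mul h1
  rw [zero_add, map_intCast] at h2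
  exact h2

/-- A nonzero form without constant term has positive degree. -/
theorem IsHomogeneousInt.pos {p : MvPolynomial (Fin n) K} {k : ℤ} (hp : IsHomogeneousInt p k)
    (h0 : p ≠ 0) (hc : constantCoeff p = 0) : 0 < k := by
  obtain ⟨s, hs⟩ := support_nonempty.2 h0
  rw [← hp s hs]
  have : s.degree ≠ 0 := fun h => by
    rw [Finsupp.degree_eq_zero_iff] at h
    rw [h, mem_support_iff] at hs
    exact hs hc
  omega

end

namespace MinimalGradedFreeResolution

variable {K : Type*} [Field K] {n : ℕ} {I : Ideal (MvPolynomial (Fin n) K)}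
  (F : MinimalGradedFreeResolution I)

/-- The map `F₁ → F₀ = R`. -/
noncomputable def toBase : (Fin (F.rank 1) → MvPolynomial (Fin n) K) →ₗ[MvPolynomial (Fin n) K]
    MvPolynomial (Fin n) K :=
  (∑ a, LinearMap.proj a) ∘ₗ F.d 0

theorem toBase_eq (a : Fin (F.rank 0)) (v) : F.toBase v = F.d 0 v a := by
  obtain ⟨_⟩ := F.unique_rank_zero
  simp only [toBase, LinearMap.comp_apply, LinearMap.proj_apply, Finset.univ_unique,
    Finset.sum_singleton]
  rw [Subsingleton.elim a default]

theorem mem_range_toBase {x : MvPolynomial (Fin n) K} : x ∈ LinearMap.range F.toBase ↔ x ∈ I := by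
  obtain ⟨_⟩ := F.unique_rank_zero
  have h := F.range_zero (fun _ => x)
  constructor
  · rintro ⟨v, rfl⟩
    rw [F.toBase_eq default]
    exact (F.range_zero _).1 ⟨v, rfl⟩ default
  · intro hx
    obtain ⟨v, hv⟩ := h.2 fun _ => hx
    exact ⟨v, by rw [F.toBase_eq default, hv]⟩

theorem exact_toBase : Function.Exact (F.d 1) F.toBase := by
  obtain ⟨_⟩ := F.unique_rank_zero
  intro v
  rw [← F.exact 0 v, F.toBase_eq default]
  constructor
  · intro h
    ext1 a
    rw [Subsingleton.elim a default, h, Pi.zero_apply]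
  · intro h
    rw [h, Pi.zero_apply]

theorem toBase_single_ne_zero (i : Fin (F.rank 1)) : F.toBase (Pi.single i 1) ≠ 0 := fun h =>
  F.single_notMem_range_d 1 i ((F.exact_toBase _).1 h)

theorem isHomogeneousInt_toBase (i : Fin (F.rank 1)) :
    IsHomogeneousInt (F.toBase (Pi.single i 1)) (F.shift 1 i) := by
  obtain ⟨_⟩ := F.unique_rank_zero
  rw [F.toBase_eq default]
  have := F.homogeneous 0 i default
  rwa [F.shift_zero, sub_zero] at this

theorem shift_one_pos (i : Fin (F.rank 1)) : 0 < F.shift 1 i := by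
  obtain ⟨_⟩ := F.unique_rank_zero
  refine (F.isHomogeneousInt_toBase i).pos (F.toBase_single_ne_zero i) ?_
  rw [F.toBase_eq default]
  exact F.constantCoeff_d 0 _ _

theorem toBase_ne_zero (hcodim : I.height = 2) : F.toBase ≠ 0 := by
  intro h
  have hI : I = ⊥ := by
    rw [eq_bot_iff]
    intro x hx
    obtain ⟨v, rfl⟩ := F.mem_range_toBase.2 hx
    rw [h]
    simp
  rw [hI] at hcodim
  simp at hcodim

/-- A common prime factor of the generators would put `I` inside a principal ideal, of height at
most one. -/
theorem not_forall_dvd_toBase (hcodim : I.height = 2) (p : MvPolynomial (Fin n) K)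
    (hp : Prime p) : ∃ i, ¬ p ∣ F.toBase (Pi.single i 1) := by
  by_contra! h
  have hle : I ≤ Ideal.span {p} := by
    intro x hx
    obtain ⟨v, rfl⟩ := F.mem_range_toBase.2 hx
    rw [← Finset.univ_sum_single v, map_sum]
    refine Ideal.sum_mem _ fun i _ => ?_
    have : (Pi.single i (v i) : Fin (F.rank 1) → MvPolynomial (Fin n) K) =
        v i • Pi.single i 1 := by
      rw [← Pi.single_smul, smul_eq_mul, mul_one]
    rw [this, map_smul]
    exact Ideal.mul_mem_left _ _ (Ideal.mem_span_singleton.2 (h i))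
  have h1 := (Ideal.height_mono hle).trans (Ideal.height_span_singleton_le_one hp.not_isUnit)
  rw [hcodim] at h1
  exact absurd h1 (by decide)

theorem rank_one_eq (hcodim : I.height = 2) (hd : F.d 2 = 0) : F.rank 1 = F.rank 2 + 1 := by
  have := card_eq_card_add_one_of_exact (F.d_one_injective hd) F.exact_toBase
    (F.toBase_ne_zero hcodim)
  simpa using this

/-- The degree relations in a Hilbert–Burch resolution. -/
theorem sum_shift_eq_and_exists_equiv (hcodim : I.height = 2) (hd : F.d 2 = 0) :
    ∑ j, F.shift 2 j = ∑ i, F.shift 1 i ∧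
      ∀ i, ∃ e : Fin (F.rank 2 + 1) ≃ Fin (F.rank 1), e 0 = i ∧
        ∀ j : Fin (F.rank 2), F.shift 1 (e j.succ) < F.shift 2 j := by
  let φ := LinearMap.toMatrix' (F.d 1)
  have hφd : ∀ v, φ.mulVec v = F.d 1 v := fun v => LinearMap.toMatrix'_mulVec _ v
  have hφ : ∀ i j, φ i j = F.d 1 (Pi.single j 1) i := fun i j => by
    simp [φ, LinearMap.toMatrix'_apply]
  let e : Fin (F.rank 2 + 1) ≃ Fin (F.rank 1) := finCongr (F.rank_one_eq hcodim hd).symm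
  obtain ⟨c, hc, hdet⟩ := exists_isUnit_det_adjoinCol_eq e (φ := φ) (f := F.toBase)
    (fun v hv => by
      rw [hφd] at hv
      exact F.d_one_injective hd (by rw [hv, map_zero]))
    (fun w => by
      rw [F.exact_toBase w]
      simp only [hφd, Set.mem_range])
    (F.toBase_ne_zero hcodim) (F.not_forall_dvd_toBase hcodim)
  have hne : ∀ i, (adjoinCol e φ (Pi.single i 1)).det ≠ 0 := fun i => by
    rw [hdet]
    exact mul_ne_zero hc.ne_zero (F.toBase_single_ne_zero i)
  -- The adjoined unit column is given degree `a i`, so that its entry `1` in row `i` has degree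
  -- zero. The same determinant is a unit constant times a form of degree `a i`, which gives `∑ b =
  -- ∑ a`.
  have hhom : ∀ i, IsHomogeneousInt (adjoinCol e φ (Pi.single i 1)).det
      (F.shift 1 i + ∑ j, F.shift 2 j - ∑ k, F.shift 1 k) := fun i => by
    have hb : F.shift 1 i + ∑ j, F.shift 2 j =
        ∑ x, (Fin.cons (F.shift 1 i) (F.shift 2) : Fin (F.rank 2 + 1) → ℤ) (e.symm x) := by
      rw [Equiv.sum_comp e.symm (Fin.cons (F.shift 1 i) (F.shift 2)), Fin.sum_univ_succ]
      simp
    rw [hb]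
    refine IsHomogeneousInt.det fun x y => ?_
    obtain ⟨t, rfl⟩ := e.surjective y
    rw [adjoinCol_apply, Equiv.symm_apply_apply]
    refine Fin.cases ?_ (fun k => ?_) t
    · rw [Fin.cons_zero, Fin.cons_zero]
      by_cases hx : x = i
      · subst hx
        rw [Pi.single_eq_same, sub_self]
        exact isHomogeneousInt_C 1
      · rw [Pi.single_eq_of_ne hx]
        intro s hs
        simp at hs
    · rw [Fin.cons_succ, Fin.cons_succ, hφ]
      exact F.homogeneous 1 k x
  constructor
  · have hrank := F.rank_one_eq hcodim hd
    let i : Fin (F.rank 1) := ⟨0, by omega⟩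
    obtain ⟨u, hu, rfl⟩ := isUnit_iff_eq_C_of_isReduced.1 hc
    obtain ⟨t, ht⟩ := support_nonempty.2 (F.toBase_single_ne_zero i)
    have h1 := F.isHomogeneousInt_toBase i t ht
    have h2 := hhom i t (by
      rw [hdet, mem_support_iff, coeff_C_mul]
      exact mul_ne_zero hu.ne_zero (mem_support_iff.1 ht))
    linarith
  · intro i
    have h1 := hne i
    rw [Matrix.det_apply'] at h1
    -- In a nonzero Leibniz term the unit column forces `σ (e 0) = i`. Every other factor is a
    -- nonzero form without constant term, hence of positive degree.
    obtain ⟨σ, -, hσ⟩ := Finset.exists_ne_zero_of_sum_ne_zero h1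
    have hσ' := Finset.prod_ne_zero_iff.1 (right_ne_zero_of_mul hσ)
    refine ⟨e.trans σ, ?_, fun j => ?_⟩
    · have := hσ' (e 0) (Finset.mem_univ _)
      rw [adjoinCol_apply, Fin.cons_zero] at this
      by_contra h
      exact this (Pi.single_eq_of_ne h _)
    · have := hσ' (e j.succ) (Finset.mem_univ _)
      rw [adjoinCol_apply, Fin.cons_succ, hφ] at this
      have h2 := (F.homogeneous 1 j (σ (e j.succ))).pos this (F.constantCoeff_d 1 _ _)
      exact sub_pos.1 h2

end MinimalGradedFreeResolution

end GradedAlg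

/-! ### The Hilbert series computed from the resolution. -/

namespace GradedAlg

open MvPolynomial

theorem _root_.Submodule.finrank_map_add_finrank_inf_ker {K V W : Type*} [Field K]
    [AddCommGroup V] [Module K V] [AddCommGroup W] [Module K W] (N : Submodule K V)
    [Module.Finite K N] (f : V →ₗ[K] W) :
    Module.finrank K (N.map f) + Module.finrank K (N ⊓ LinearMap.ker f : Submodule K V) =
      Module.finrank K N := by
  rw [← LinearMap.finrank_range_add_finrank_ker (f.domRestrict N), LinearMap.range_domRestrict,
    LinearMap.ker_domRestrict, ← Submodule.map_comap_subtype, Submodule.finrank_map_subtype_eq]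

section HilbertFunction

variable (K : Type*) [Field K] (n : ℕ)

/-- The space of forms of degree `k ∈ ℤ`. -/
noncomputable def forms (k : ℤ) : Submodule K (MvPolynomial (Fin n) K) :=
  restrictSupport K {s | (s.degree : ℤ) = k}

variable {K n}

theorem mem_forms {k : ℤ} {p : MvPolynomial (Fin n) K} :
    p ∈ forms K n k ↔ IsHomogeneousInt p k := by
  rw [forms, mem_restrictSupport_iff]
  rfl

theorem forms_natCast (k : ℕ) : forms K n k = homogeneousSubmodule (Fin n) K k := by
  ext p
  rw [mem_forms, mem_homogeneousSubmodule, IsHomogeneousInt, IsHomogeneous.eq_1,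
    IsWeightedHomogeneous]
  refine forall_congr' fun s => ?_
  rw [mem_support_iff, Nat.cast_inj, Finsupp.degree_eq_weight_one]
  rfl

theorem coe_finsuppAntidiag_univ (k : ℕ) :
    ((Finset.univ.finsuppAntidiag k : Finset (Fin n →₀ ℕ)) : Set (Fin n →₀ ℕ)) =
      {s | (s.degree : ℤ) = (k : ℤ)} := by
  ext s
  simp [Finset.mem_finsuppAntidiag, Finsupp.degree_eq_sum]
  norm_cast

instance finite_degree_eq (k : ℤ) : Finite {s : Fin n →₀ ℕ | (s.degree : ℤ) = k} := by
  rcases lt_or_ge k 0 with hk | hk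
  · have : {s : Fin n →₀ ℕ | (s.degree : ℤ) = k} = ∅ := by
      ext s
      simp only [Set.mem_ofPred_eq, Set.mem_empty_iff_false, iff_false]
      omega
    rw [this]
    infer_instance
  · lift k to ℕ using hk
    rw [← coe_finsuppAntidiag_univ]
    infer_instance

instance finite_forms (k : ℤ) : Module.Finite K (forms K n k) :=
  Module.Finite.of_basis (basisRestrictSupport K _)

theorem finrank_forms_natCast (k : ℕ) :
    Module.finrank K (forms K n k) = (n + k - 1).choose k := by
  rw [forms, Module.finrank_eq_nat_card_basis (basisRestrictSupport K _),
    ← coe_finsuppAntidiag_univ, Nat.card_eq_fintype_card]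
  simp [Finset.card_finsuppAntidiag_nat_eq_choose]

theorem finrank_forms_of_neg {k : ℤ} (hk : k < 0) : Module.finrank K (forms K n k) = 0 := by
  have : IsEmpty {s : Fin n →₀ ℕ | (s.degree : ℤ) = k} := ⟨fun s => by
    have := s.2
    simp only [Set.mem_ofPred_eq] at this
    omega⟩
  rw [forms, Module.finrank_eq_nat_card_basis (basisRestrictSupport K _), Nat.card_of_isEmpty]

variable (K n) in
/-- The Hilbert series of the polynomial ring is `1 / (1 - t) ^ n`. -/
theorem mk_finrank_forms_mul_pow :
    PowerSeries.mk (fun k => (Module.finrank K (forms K n k) : ℤ)) *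
      (1 - PowerSeries.X) ^ n = 1 := by
  simp only [finrank_forms_natCast]
  -- For `n = 0` the truncated `n + k - 1` gives `1` when `k = 0` and `0` otherwise, as it should.
  obtain _ | n := n
  · rw [pow_zero, mul_one]
    ext k
    rw [PowerSeries.coeff_mk, PowerSeries.coeff_one]
    obtain _ | k := k
    · simp
    · simp
  · refine Eq.trans ?_ (PowerSeries.mk_add_choose_mul_one_sub_pow_eq_one ℤ n)
    congr 1
    ext k
    rw [PowerSeries.coeff_mk, PowerSeries.coeff_mk, show n + 1 + k - 1 = n + k by omega,
      Nat.choose_symm_add]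

/-- The Hilbert series of `R(-a)` is `t ^ a / (1 - t) ^ n`. -/
theorem mk_finrank_forms_sub_mul_pow (a : ℕ) :
    PowerSeries.mk (fun k => (Module.finrank K (forms K n (k - a)) : ℤ)) *
      (1 - PowerSeries.X) ^ n = PowerSeries.X ^ a := by
  have : PowerSeries.mk (fun k => (Module.finrank K (forms K n (k - a)) : ℤ)) =
      PowerSeries.X ^ a * PowerSeries.mk (fun k => (Module.finrank K (forms K n k) : ℤ)) := by
    ext k
    rw [PowerSeries.coeff_X_pow_mul', PowerSeries.coeff_mk]
    split_ifs with h
    · rw [PowerSeries.coeff_mk, Nat.cast_sub h]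
    · rw [finrank_forms_of_neg (by omega), Nat.cast_zero]
  rw [this, mul_assoc, mk_finrank_forms_mul_pow, mul_one]

/-- The component of degree `k` of the graded free module `⨁ₐ R(-δ a)`. -/
noncomputable def freeForms {r : ℕ} (δ : Fin r → ℤ) (k : ℤ) :
    Submodule K (Fin r → MvPolynomial (Fin n) K) :=
  Submodule.pi Set.univ fun a => forms K n (k - δ a)

theorem mem_freeForms {r : ℕ} {δ : Fin r → ℤ} {k : ℤ} {v : Fin r → MvPolynomial (Fin n) K} :
    v ∈ freeForms δ k ↔ ∀ a, IsHomogeneousInt (v a) (k - δ a) := by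
  simp [freeForms, Submodule.mem_pi, mem_forms]

/-- The degree `k` component of `⨁ₐ R(-δ a)` as a product of spaces of forms. -/
noncomputable def freeFormsEquiv {r : ℕ} (δ : Fin r → ℤ) (k : ℤ) :
    (freeForms δ k : Submodule K (Fin r → MvPolynomial (Fin n) K)) ≃ₗ[K]
      Π a, forms K n (k - δ a) where
  toFun v a := ⟨v.1 a, mem_forms.2 (mem_freeForms.1 v.2 a)⟩
  invFun w := ⟨fun a => (w a).1, mem_freeForms.2 fun a => mem_forms.1 (w a).2⟩
  map_add' _ _ := rfl
  map_smul' _ _ := rfl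
  left_inv _ := rfl
  right_inv _ := rfl

instance finite_freeForms {r : ℕ} (δ : Fin r → ℤ) (k : ℤ) :
    Module.Finite K (freeForms δ k : Submodule K (Fin r → MvPolynomial (Fin n) K)) :=
  Module.Finite.equiv (freeFormsEquiv δ k).symm

theorem finrank_freeForms {r : ℕ} (δ : Fin r → ℤ) (k : ℤ) :
    Module.finrank K (freeForms δ k : Submodule K (Fin r → MvPolynomial (Fin n) K)) =
      ∑ a, Module.finrank K (forms K n (k - δ a)) := by
  rw [(freeFormsEquiv δ k).finrank_eq, Module.finrank_pi_fintype]

theorem componentInt_eq_self {k : ℤ} {p : MvPolynomial (Fin n) K} (hp : IsHomogeneousInt p k) :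
    componentInt k p = p := by
  ext s
  rw [coeff_componentInt]
  split_ifs with h
  · rfl
  · by_contra h0
    exact h (hp s (mem_support_iff.2 (Ne.symm h0)))

/-- A preimage of a vector of degree `k` may be replaced by its own component of degree `k`. Hence
exactness passes to each graded strand. -/
theorem map_freeForms_of_homogeneous {r t : ℕ} {δ : Fin r → ℤ} {ε : Fin t → ℤ}
    {f : (Fin t → MvPolynomial (Fin n) K) →ₗ[MvPolynomial (Fin n) K]
      (Fin r → MvPolynomial (Fin n) K)}
    (hf : ∀ b a, IsHomogeneousInt (f (Pi.single b 1) a) (ε b - δ a)) (k : ℤ) :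
    (freeForms ε k).map (f.restrictScalars K) =
      freeForms δ k ⊓ LinearMap.range (f.restrictScalars K) := by
  have hf' : ∀ v a, f v a = ∑ b, v b * f (Pi.single b 1) a := fun v a => by
    conv_lhs => rw [← Finset.univ_sum_single v, map_sum, Finset.sum_apply]
    refine Finset.sum_congr rfl fun b _ => ?_
    have : (Pi.single b (v b) : Fin t → MvPolynomial (Fin n) K) = v b • Pi.single b 1 := by
      rw [← Pi.single_smul, smul_eq_mul, mul_one]
    rw [this, map_smul]
    rfl
  ext w
  constructor
  · rintro ⟨v, hv, rfl⟩
    refine ⟨mem_freeForms.2 fun a => ?_, v, rfl⟩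
    rw [LinearMap.restrictScalars_apply, hf']
    refine IsHomogeneousInt.sum fun b _ => ?_
    have := (mem_freeForms.1 hv b).mul (hf b a)
    rwa [sub_add_sub_cancel] at this
  · rintro ⟨hw, v, rfl⟩
    refine ⟨fun b => componentInt (k - ε b) (v b),
      mem_freeForms.2 fun b => isHomogeneousInt_componentInt _ _, ?_⟩
    funext a
    have h1 := componentInt_eq_self (mem_freeForms.1 hw a)
    rw [LinearMap.restrictScalars_apply, hf'] at h1 ⊢
    rw [LinearMap.restrictScalars_apply, hf' v, ← h1, componentInt_sum]
    refine Finset.sum_congr rfl fun b _ => ?_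
    rw [componentInt_mul (hf b a)]
    congr 2
    ring

end HilbertFunction

namespace MinimalGradedFreeResolution

variable {K : Type*} [Field K] {n : ℕ} {I : Ideal (MvPolynomial (Fin n) K)}
  (F : MinimalGradedFreeResolution I)

theorem map_augmentation_freeForms (k : ℕ) :
    (freeForms (F.shift 0) (k : ℤ)).map (F.augmentation.restrictScalars K) = gradedPiece I k := by
  obtain ⟨_⟩ := F.unique_rank_zero
  have haug : ∀ v, F.augmentation v = Ideal.Quotient.mk I (v default) := fun v => by
    simp [augmentation]
  rw [gradedPiece, ← forms_natCast]
  ext y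
  constructor
  · rintro ⟨v, hv, rfl⟩
    have := mem_freeForms.1 hv default
    rw [F.shift_zero, sub_zero] at this
    exact ⟨v default, mem_forms.2 this, (haug v).symm⟩
  · rintro ⟨x, hx, rfl⟩
    refine ⟨fun _ => x, mem_freeForms.2 fun a => ?_, haug _⟩
    rw [F.shift_zero, sub_zero]
    exact mem_forms.1 hx

theorem freeForms_inf_ker_d (i : ℕ) (k : ℤ) :
    freeForms (F.shift (i + 1)) k ⊓ LinearMap.ker ((F.d i).restrictScalars K) =
      (freeForms (F.shift (i + 2)) k).map ((F.d (i + 1)).restrictScalars K) := by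
  rw [map_freeForms_of_homogeneous (F.homogeneous (i + 1))]
  congr 1
  ext v
  exact F.exact i v

/-- Rank–nullity along the degree `k` strand, which ends on the left because `F.d 1` is injective.
-/
theorem finrank_gradedPiece (h : F.d 2 = 0) (k : ℕ) :
    (Module.finrank K (gradedPiece I k) : ℤ) = Module.finrank K (forms K n k) -
      ∑ a, (Module.finrank K (forms K n (k - F.shift 1 a)) : ℤ) +
      ∑ b, (Module.finrank K (forms K n (k - F.shift 2 b)) : ℤ) := by
  obtain ⟨_⟩ := F.unique_rank_zero
  have h0 := (freeForms (F.shift 0) (k : ℤ)).finrank_map_add_finrank_inf_ker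
    (F.augmentation.restrictScalars K)
  have h1 := (freeForms (F.shift 1) (k : ℤ)).finrank_map_add_finrank_inf_ker
    ((F.d 0).restrictScalars K)
  have hker : freeForms (F.shift 0) (k : ℤ) ⊓ LinearMap.ker (F.augmentation.restrictScalars K) =
      (freeForms (F.shift 1) (k : ℤ)).map ((F.d 0).restrictScalars K) := by
    rw [map_freeForms_of_homogeneous (F.homogeneous 0)]
    congr 1
    ext v
    exact F.exact_augmentation v
  have h2 : Module.finrank K ((freeForms (F.shift 2) (k : ℤ)).map ((F.d 1).restrictScalars K)) =
      Module.finrank K (freeForms (F.shift 2) (k : ℤ)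
        : Submodule K (Fin (F.rank 2) → MvPolynomial (Fin n) K)) :=
    LinearEquiv.finrank_eq
      (Submodule.equivMapOfInjective ((F.d 1).restrictScalars K) (F.d_one_injective h) _).symm
  rw [F.map_augmentation_freeForms, hker, finrank_freeForms, Finset.univ_unique,
    Finset.sum_singleton, F.shift_zero, sub_zero] at h0
  rw [F.freeForms_inf_ker_d 0, h2, finrank_freeForms, finrank_freeForms] at h1
  zify at h0 h1
  linarith

theorem hilbertSeries_mul_pow (hd : F.d 2 = 0) (h2 : ∀ b, 0 ≤ F.shift 2 b) :
    hilbertSeries I * (1 - PowerSeries.X) ^ n =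
      1 - ∑ a, PowerSeries.X ^ (F.shift 1 a).toNat + ∑ b, PowerSeries.X ^ (F.shift 2 b).toNat := by
  have hsum : hilbertSeries I = PowerSeries.mk (fun k => (Module.finrank K (forms K n k) : ℤ)) -
      ∑ a, PowerSeries.mk
        (fun k => (Module.finrank K (forms K n (k - (F.shift 1 a).toNat)) : ℤ)) +
      ∑ b, PowerSeries.mk
        (fun k => (Module.finrank K (forms K n (k - (F.shift 2 b).toNat)) : ℤ)) := by
    ext k
    simp only [hilbertSeries, map_add, map_sub, map_sum, PowerSeries.coeff_mk,
      F.finrank_gradedPiece hd]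
    congr 1
    · congr 1
      exact Finset.sum_congr rfl fun a _ => by rw [Int.toNat_of_nonneg (F.shift_one_pos a).le]
    · exact Finset.sum_congr rfl fun b _ => by rw [Int.toNat_of_nonneg (h2 b)]
  rw [hsum, add_mul, sub_mul, Finset.sum_mul, Finset.sum_mul, mk_finrank_forms_mul_pow]
  simp only [mk_finrank_forms_sub_mul_pow]

end MinimalGradedFreeResolution

end GradedAlg

/-! ### The multiplicity in terms of the shifts, and the equality cases. -/

namespace GradedAlg

open MvPolynomial

/-- Taylor expansion at `1`. Applied to the numerator over `(1 - t) ^ n`, the cofactor `Q` is the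
reduced numerator. -/
theorem _root_.Polynomial.exists_eq_one_sub_X_sq_mul {P : Polynomial ℤ} (h0 : P.eval 1 = 0)
    (h1 : P.derivative.eval 1 = 0) :
    ∃ Q : Polynomial ℤ, P = (1 - Polynomial.X) ^ 2 * Q ∧
      2 * Q.eval 1 = P.derivative.derivative.eval 1 := by
  obtain ⟨S, rfl⟩ := Polynomial.dvd_iff_isRoot.2 h0
  have h2 : S.eval 1 = 0 := by simpa using h1
  obtain ⟨Q, rfl⟩ := Polynomial.dvd_iff_isRoot.2 h2
  refine ⟨Q, by rw [Polynomial.C_1]; ring, ?_⟩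
  simp
  ring

theorem _root_.Polynomial.eval_one_derivative_derivative_X_pow (a : ℕ) :
    (Polynomial.X ^ a : Polynomial ℤ).derivative.derivative.eval 1 = (a : ℤ) ^ 2 - a := by
  obtain _ | a := a
  · simp
  · simp [Polynomial.derivative_X_pow]
    ring

namespace MinimalGradedFreeResolution

variable {K : Type*} [Field K] {n : ℕ} {I : Ideal (MvPolynomial (Fin n) K)}
  (F : MinimalGradedFreeResolution I)

theorem shift_two_pos (hcodim : I.height = 2) (hd : F.d 2 = 0) (b : Fin (F.rank 2)) :
    0 < F.shift 2 b := by
  have hr := F.rank_one_eq hcodim hd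
  obtain ⟨e, -, he⟩ := (F.sum_shift_eq_and_exists_equiv hcodim hd).2 ⟨0, by omega⟩
  exact (F.shift_one_pos _).trans (he b)

/-- With `F₂ = 0` the sum of the positive shifts of `F₁` would be zero. Hence `minShift 2` and
`maxShift 2` are never the default value on an empty set. -/
theorem rank_two_pos (hcodim : I.height = 2) (hd : F.d 2 = 0) : 0 < F.rank 2 := by
  by_contra h0
  have hr := F.rank_one_eq hcodim hd
  have : IsEmpty (Fin (F.rank 2)) := by
    rw [Nat.eq_zero_of_not_pos h0]
    infer_instance
  have hsum := (F.sum_shift_eq_and_exists_equiv hcodim hd).1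
  rw [Finset.univ_eq_empty, Finset.sum_empty] at hsum
  have : 0 < ∑ i, F.shift 1 i :=
    Finset.sum_pos (fun i _ => F.shift_one_pos i) ⟨⟨0, by omega⟩, Finset.mem_univ _⟩
  omega

theorem two_mul_multiplicity (hcodim : I.height = 2) (hd : F.d 2 = 0)
    (hpos : ∑ b, F.shift 2 b ^ 2 - ∑ a, F.shift 1 a ^ 2 ≠ 0) :
    2 * multiplicity I = ∑ b, F.shift 2 b ^ 2 - ∑ a, F.shift 1 a ^ 2 := by
  have hn := le_of_height_eq_two hcodim
  have hr := F.rank_one_eq hcodim hd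
  have hsum := (F.sum_shift_eq_and_exists_equiv hcodim hd).1
  have ha : ∀ a, ((F.shift 1 a).toNat : ℤ) = F.shift 1 a := fun a =>
    Int.toNat_of_nonneg (F.shift_one_pos a).le
  have hb : ∀ b, ((F.shift 2 b).toNat : ℤ) = F.shift 2 b := fun b =>
    Int.toNat_of_nonneg (F.shift_two_pos hcodim hd b).le
  let P : Polynomial ℤ := 1 - ∑ a, Polynomial.X ^ (F.shift 1 a).toNat +
    ∑ b, Polynomial.X ^ (F.shift 2 b).toNat
  have hP : hilbertSeries I * (1 - PowerSeries.X) ^ n = (P : PowerSeries ℤ) := by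
    rw [F.hilbertSeries_mul_pow hd fun b => (F.shift_two_pos hcodim hd b).le]
    have hcoe : ∀ {r : ℕ} (c : Fin r → ℕ),
        ((∑ a, Polynomial.X ^ c a : Polynomial ℤ) : PowerSeries ℤ) = ∑ a, PowerSeries.X ^ c a :=
      fun c => by
        rw [← Polynomial.coeToPowerSeries.ringHom_apply, map_sum]
        simp
    simp only [P, Polynomial.coe_add, Polynomial.coe_sub, Polynomial.coe_one, hcoe]
  have h0 : P.eval 1 = 0 := by
    simp [P, Polynomial.eval_finsetSum, hr]
  have h1 : P.derivative.eval 1 = 0 := by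
    simp [P, Polynomial.eval_finsetSum, Polynomial.derivative_X_pow, ha, hb, hsum]
  have h2 : P.derivative.derivative.eval 1 = ∑ b, F.shift 2 b ^ 2 - ∑ a, F.shift 1 a ^ 2 := by
    simp only [P, Polynomial.derivative_add, Polynomial.derivative_sub, Polynomial.derivative_one,
      Polynomial.derivative_sum, Polynomial.derivative_zero, Polynomial.eval_add,
      Polynomial.eval_sub, Polynomial.eval_zero, Polynomial.eval_finsetSum,
      Polynomial.eval_one_derivative_derivative_X_pow, ha, hb, Finset.sum_sub_distrib, hsum]
    ring
  obtain ⟨Q, hQ, hQ2⟩ := Polynomial.exists_eq_one_sub_X_sq_mul h0 h1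
  rw [h2] at hQ2
  have hX : (1 - PowerSeries.X : PowerSeries ℤ) ^ 2 ≠ 0 := by
    refine pow_ne_zero _ fun h => ?_
    simpa using congrArg PowerSeries.constantCoeff h
  have hmult : HasMultiplicity I (Q.eval 1) := by
    -- Cancelling `(1 - t) ^ 2` leaves the exponent `n - 2`, not truncated because `2 ≤ n`; `hpos`
    -- is what makes `Q(1)` nonzero.
    refine ⟨n - 2, Q, fun h => hpos (by rw [← hQ2, h, mul_zero]), ?_, rfl⟩
    refine mul_left_cancel₀ hX ?_
    have h3 : (P : PowerSeries ℤ) = (1 - PowerSeries.X) ^ 2 * (Q : PowerSeries ℤ) := by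
      rw [hQ]
      simp
    rw [← h3, ← hP, mul_left_comm, ← pow_add, Nat.add_sub_cancel' hn]
  rw [hmult.eq, hQ2]

/-- Expand `b² - a²` as a product and use `∑ (b j - a (e j)) = a i`. The parameter `m` is free, to
be set to the least or greatest shift of `F₂`. -/
theorem sum_sq_sub_sum_sq (hcodim : I.height = 2) (hd : F.d 2 = 0)
    {i : Fin (F.rank 1)} {e : Fin (F.rank 2 + 1) ≃ Fin (F.rank 1)} (he : e 0 = i) (m : ℤ) :
    ∑ b, F.shift 2 b ^ 2 - ∑ a, F.shift 1 a ^ 2 = F.shift 1 i * m +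
      ∑ j, (F.shift 2 j - F.shift 1 (e j.succ)) *
        ((F.shift 2 j - m) + (F.shift 1 (e j.succ) - F.shift 1 i)) := by
  have hsum := (F.sum_shift_eq_and_exists_equiv hcodim hd).1
  rw [← Equiv.sum_comp e, Fin.sum_univ_succ, he] at hsum
  rw [← Equiv.sum_comp e, Fin.sum_univ_succ, he]
  have h1 : ∑ j, (F.shift 2 j - F.shift 1 (e j.succ)) *
      ((F.shift 2 j - m) + (F.shift 1 (e j.succ) - F.shift 1 i)) =
      ∑ j, F.shift 2 j ^ 2 - ∑ j : Fin (F.rank 2), F.shift 1 (e j.succ) ^ 2 -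
      (m + F.shift 1 i) * (∑ j, F.shift 2 j - ∑ j : Fin (F.rank 2), F.shift 1 (e j.succ)) := by
    rw [← Finset.sum_sub_distrib, ← Finset.sum_sub_distrib, Finset.mul_sum,
      ← Finset.sum_sub_distrib]
    exact Finset.sum_congr rfl fun j _ => by ring
  rw [h1, hsum]
  ring

theorem setOf_betti_ne_zero (i : ℕ) : {j | F.betti i j ≠ 0} = Set.range (F.shift i) := by
  ext j
  simp [betti, Finset.filter_eq_empty_iff]

theorem minShift_mem {i : ℕ} (h : 0 < F.rank i) : ∃ a, F.shift i a = F.minShift i := by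
  have : Nonempty (Fin (F.rank i)) := ⟨⟨0, h⟩⟩
  have := Int.csInf_mem (Set.range_nonempty (F.shift i)) (Set.finite_range _).bddBelow
  rwa [minShift, setOf_betti_ne_zero]

theorem maxShift_mem {i : ℕ} (h : 0 < F.rank i) : ∃ a, F.shift i a = F.maxShift i := by
  have : Nonempty (Fin (F.rank i)) := ⟨⟨0, h⟩⟩
  have := Int.csSup_mem (Set.range_nonempty (F.shift i)) (Set.finite_range _).bddAbove
  rwa [maxShift, setOf_betti_ne_zero]

theorem minShift_le {i : ℕ} (a : Fin (F.rank i)) : F.minShift i ≤ F.shift i a := by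
  rw [minShift, setOf_betti_ne_zero]
  exact csInf_le (Set.finite_range _).bddBelow ⟨a, rfl⟩

theorem le_maxShift {i : ℕ} (a : Fin (F.rank i)) : F.shift i a ≤ F.maxShift i := by
  rw [maxShift, setOf_betti_ne_zero]
  exact le_csSup (Set.finite_range _).bddAbove ⟨a, rfl⟩

theorem minShift_eq_maxShift {i : ℕ} (h : 0 < F.rank i) {c : ℤ} (hc : ∀ a, F.shift i a = c) :
    F.minShift i = F.maxShift i := by
  obtain ⟨a, ha⟩ := F.minShift_mem h
  obtain ⟨b, hb⟩ := F.maxShift_mem h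
  rw [← ha, ← hb, hc, hc]

theorem isPure_of_shift_eq (hd : F.d 2 = 0) {c₁ c₂ : ℤ}
    (h1 : ∀ a, F.shift 1 a = c₁) (h2 : ∀ b, F.shift 2 b = c₂) : F.IsPure := by
  intro i hi
  have hi' := Nat.pos_of_ne_zero hi
  match i with
  | 0 => exact F.minShift_eq_maxShift hi' F.shift_zero
  | 1 => exact F.minShift_eq_maxShift hi' h1
  | 2 => exact F.minShift_eq_maxShift hi' h2
  | i + 3 => exact absurd (F.rank_eq_zero_of_three_le hd (by omega)) hi

/-- The degrees in the first two steps are the constants `F.shift 1 i` and `c` as soon as the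
products of degree differences vanish. -/
theorem isPure_of_sum_eq_zero (hd : F.d 2 = 0)
    {i : Fin (F.rank 1)} {e : Fin (F.rank 2 + 1) ≃ Fin (F.rank 1)} (he : e 0 = i)
    (hlt : ∀ j : Fin (F.rank 2), F.shift 1 (e j.succ) < F.shift 2 j) {c : ℤ}
    (h : ∀ j, (F.shift 2 j - F.shift 1 (e j.succ)) *
        ((F.shift 2 j - c) + (F.shift 1 (e j.succ) - F.shift 1 i)) = 0)
    (hs : (∀ a, F.shift 1 i ≤ F.shift 1 a) ∧ (∀ b, c ≤ F.shift 2 b) ∨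
      (∀ a, F.shift 1 a ≤ F.shift 1 i) ∧ (∀ b, F.shift 2 b ≤ c)) : F.IsPure := by
  have key : ∀ j, F.shift 2 j = c ∧ F.shift 1 (e j.succ) = F.shift 1 i := fun j => by
    -- The first factor is positive, so the second vanishes; its two terms have the same sign, so
    -- both are zero.
    have h1 := (mul_eq_zero.1 (h j)).resolve_left (sub_pos.2 (hlt j)).ne'
    rcases hs with hs | hs
    · have := hs.1 (e j.succ)
      have := hs.2 j
      omega
    · have := hs.1 (e j.succ)
      have := hs.2 j
      omega
  refine F.isPure_of_shift_eq hd (c₁ := F.shift 1 i) (fun a => ?_) fun b => (key b).1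
  obtain ⟨t, rfl⟩ := e.surjective a
  refine Fin.cases (by rw [he]) (fun j => (key j).2) t

theorem minShift_one_mul_le_and_isPure (hcodim : I.height = 2) (hd : F.d 2 = 0) :
    F.minShift 1 * F.minShift 2 ≤ ∑ b, F.shift 2 b ^ 2 - ∑ a, F.shift 1 a ^ 2 ∧
    (∑ b, F.shift 2 b ^ 2 - ∑ a, F.shift 1 a ^ 2 = F.minShift 1 * F.minShift 2 → F.IsPure) := by
  have hr := F.rank_one_eq hcodim hd
  obtain ⟨i, hi⟩ := F.minShift_mem (i := 1) (by omega)
  obtain ⟨e, he, hlt⟩ := (F.sum_shift_eq_and_exists_equiv hcodim hd).2 i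
  have h := F.sum_sq_sub_sum_sq hcodim hd he (F.minShift 2)
  have ha : ∀ a, F.shift 1 i ≤ F.shift 1 a := fun a => hi ▸ F.minShift_le a
  have hb : ∀ b, F.minShift 2 ≤ F.shift 2 b := F.minShift_le
  have hnn : ∀ j ∈ Finset.univ, 0 ≤ (F.shift 2 j - F.shift 1 (e j.succ)) *
      ((F.shift 2 j - F.minShift 2) + (F.shift 1 (e j.succ) - F.shift 1 i)) := fun j _ =>
    mul_nonneg (sub_pos.2 (hlt j)).le
      (add_nonneg (sub_nonneg.2 (hb j)) (sub_nonneg.2 (ha _)))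
  rw [← hi, h]
  refine ⟨le_add_of_nonneg_right (Finset.sum_nonneg hnn), fun h0 => ?_⟩
  have h1 := (Finset.sum_eq_zero_iff_of_nonneg hnn).1 (add_eq_left.1 h0)
  exact F.isPure_of_sum_eq_zero hd he hlt (fun j => h1 j (Finset.mem_univ j))
    (Or.inl ⟨ha, hb⟩)

theorem isPure_of_eq_maxShift (hcodim : I.height = 2) (hd : F.d 2 = 0)
    (h0 : ∑ b, F.shift 2 b ^ 2 - ∑ a, F.shift 1 a ^ 2 = F.maxShift 1 * F.maxShift 2) :
    F.IsPure := by
  have hr := F.rank_one_eq hcodim hd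
  obtain ⟨i, hi⟩ := F.maxShift_mem (i := 1) (by omega)
  obtain ⟨e, he, hlt⟩ := (F.sum_shift_eq_and_exists_equiv hcodim hd).2 i
  have h := F.sum_sq_sub_sum_sq hcodim hd he (F.maxShift 2)
  have ha : ∀ a, F.shift 1 a ≤ F.shift 1 i := fun a => hi ▸ F.le_maxShift a
  have hb : ∀ b, F.shift 2 b ≤ F.maxShift 2 := F.le_maxShift
  have hnp : ∀ j ∈ Finset.univ, (F.shift 2 j - F.shift 1 (e j.succ)) *
      ((F.shift 2 j - F.maxShift 2) + (F.shift 1 (e j.succ) - F.shift 1 i)) ≤ 0 := fun j _ =>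
    mul_nonpos_of_nonneg_of_nonpos (sub_pos.2 (hlt j)).le
      (add_nonpos (sub_nonpos.2 (hb j)) (sub_nonpos.2 (ha _)))
  rw [← hi, h] at h0
  have h1 := (Finset.sum_eq_zero_iff_of_nonpos hnp).1 (add_eq_left.1 h0)
  exact F.isPure_of_sum_eq_zero hd he hlt (fun j => h1 j (Finset.mem_univ j))
    (Or.inr ⟨ha, hb⟩)

theorem sum_sq_sub_sum_sq_of_isPure (hcodim : I.height = 2) (hd : F.d 2 = 0) (h : F.IsPure) :
    ∑ b, F.shift 2 b ^ 2 - ∑ a, F.shift 1 a ^ 2 = F.minShift 1 * F.minShift 2 := by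
  have hr := F.rank_one_eq hcodim hd
  have hconst : ∀ {k} (a : Fin (F.rank k)), F.shift k a = F.minShift k := fun {k} a =>
    le_antisymm ((h k (by rintro h0; exact (h0 ▸ a).elim0)) ▸ F.le_maxShift a) (F.minShift_le a)
  obtain ⟨e, he, -⟩ := (F.sum_shift_eq_and_exists_equiv hcodim hd).2 ⟨0, by omega⟩
  rw [F.sum_sq_sub_sum_sq hcodim hd he (F.minShift 2)]
  simp [hconst]

end MinimalGradedFreeResolution

end GradedAlg

theorem corollary1p3 {K : Type*} [Field K] {n : ℕ} (I : Ideal (MvPolynomial (Fin n) K))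
    (hI : GradedAlg.IsGradedIdeal I) (hcodim : I.height = 2)
    (hCM : GradedAlg.IsCohenMacaulayRing (MvPolynomial (Fin n) K ⧸ I))
    (F : GradedAlg.MinimalGradedFreeResolution I) :
    [(GradedAlg.multiplicity I : ℚ) = 1 / 2 * F.minShift 1 * F.minShift 2,
     (GradedAlg.multiplicity I : ℚ) = 1 / 2 * F.maxShift 1 * F.maxShift 2,
     F.IsPure].TFAE := by
  have hd := F.d_two_eq_zero hI hcodim hCM
  have hr := F.rank_one_eq hcodim hd
  have hr2 := F.rank_two_pos hcodim hd
  obtain ⟨i, hi⟩ := F.minShift_mem (i := 1) (by omega)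
  obtain ⟨j, hj⟩ := F.minShift_mem hr2
  obtain ⟨hle, hmin⟩ := F.minShift_one_mul_le_and_isPure hcodim hd
  have hpos : 0 < F.minShift 1 * F.minShift 2 :=
    mul_pos (hi ▸ F.shift_one_pos i) (hj ▸ F.shift_two_pos hcodim hd j)
  -- The lower bound by the positive number `m₁m₂` supplies the nonvanishing that the multiplicity
  -- formula needs.
  have hmult := F.two_mul_multiplicity hcodim hd (hpos.trans_le hle).ne'
  have hiff : ∀ x y : ℤ, (GradedAlg.multiplicity I : ℚ) = 1 / 2 * x * y ↔
      2 * GradedAlg.multiplicity I = x * y := fun x y => by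
    rw [← Int.cast_inj (α := ℚ)]
    push_cast
    constructor <;> intro h <;> linarith
  rw [hiff, hiff, hmult]
  tfae_have 1 → 3 := hmin
  tfae_have 2 → 3 := F.isPure_of_eq_maxShift hcodim hd
  tfae_have 3 → 1 := F.sum_sq_sub_sum_sq_of_isPure hcodim hd
  tfae_have 3 → 2 := fun h => by
    rw [← h 1 (by omega), ← h 2 hr2.ne']
    exact F.sum_sq_sub_sum_sq_of_isPure hcodim hd h
  tfae_finish
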